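/- Let $K$ be a field of characteristic $0$, let $\ell\ge 2$, and let $N=(N_2,\dots,N_\ell)$ be a tuple of finite subsets of $K$. The $N$-Ish arrangement in $K^\ell$ (coordinates $x_1,\dots,x_\ell$) consists of the affine hyperplanes $\{x_1-x_j=a\}$ for $2\le j\le \ell$, $a\in N_j$, and $\{x_i-x_j=0\}$ for $2\le i<j\le\ell$. Let $\mathcal I_N$ be the cone over it, that is, the central arrangement in $K^{\ell+1}$ (coordinates $x_1,\dots,x_\ell,z$) consisting of $\{z=0\}$, of $\{x_1-x_j=az\}$ for $2\le j\le\ell$, $a\in N_j$, and of $\{x_i-x_j=0\}$ for $2\le i<j\le\ell$. Then the following four conditions are equivalent: 1. $N$ is a nest, i.e. $N_{w(2)}\subseteq N_{w(3)}\subseteq\dots\subseteq N_{w(\ell)}$ for some permutation $w$ of $\{2,\dots,\ell\}$; 2. $\mathcal I_N$ is supersolvable; 3. $\mathcal I_N$ is inductively free; 4. $\mathcal I_N$ is free. Here, for a central arrangement $\mathcal A$ (a finite set of linear hyperplanes) in a finite-dimensional $K$-vector space $V$, let $L(\mathcal A)$ be the lattice of all intersections of members of $\mathcal A$ (including $V$,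 the empty intersection) ordered by reverse inclusion, let $S=\mathrm{Sym}(V^*)$, and let $D(\mathcal A)$ be the $S$-module of all $K$-linear derivations $\theta:S\to S$ such that $\theta(\alpha)\in\alpha S$ for every linear form $\alpha$ with $\ker\alpha\in\mathcal A$. * $\mathcal A$ is supersolvable if $L(\mathcal A)$ is supersolvable in the sense of Stanley: there is a maximal chain $\Delta$ of $L(\mathcal A)$ such that for every chain $C$ of $L(\mathcal A)$ the sublattice generated by $\Delta\cup C$ is distributive. * $\mathcal A$ is free if $D(\mathcal A)$ is a free $S$-module. Its exponents $\exp\mathcal A$ are then the multiset of degrees of a homogeneous basis of $D(\mathcal A)$, where $\theta$ is homogeneous of degree $d$ if $\theta(\alpha)$ is homogeneous of degree $d$ for every $\alpha\in V^*$. * Inductive freeness is defined recursively: the empty arrangement in any finite-dimensional space is inductively free, and $\mathcal A$ is inductively free if there is $H\in\mathcal A$ such that $\mathcal A'=\mathcal A\setminus\{H\}$ and $\mathcal A''=\{H'\cap H\mid H'\in\mathcal A'\}$ (an arrangement in $H$) are inductively free and $\exp\mathcal A''\subseteq\exp\mathcal A'$ as multisets. -/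

import Mathlib

/-! ## Supersolvable lattices -/

section Lattices

variable {L : Type*} [Lattice L]

/-- A sublattice, given by its carrier `s`, is distributive. -/
def IsDistributiveOn (s : Set L) : Prop :=
  ∀ x ∈ s, ∀ y ∈ s, ∀ z ∈ s, x ⊓ (y ⊔ z) = (x ⊓ y) ⊔ (x ⊓ z)

/-- Stanley's M-chains: a maximal chain `Δ` such that, for every chain `C`, the sublattice
generated by `Δ` and `C` is distributive. -/
def IsMChain (Δ : Set L) : Prop :=
  IsMaxChain (· ≤ ·) Δ ∧
    ∀ C : Set L, IsChain (· ≤ ·) C → IsDistributiveOn (latticeClosure (Δ ∪ C))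

variable (L) in
/-- Stanley's notion of a supersolvable (finite) lattice: there is an M-chain. -/
def IsSupersolvableLattice : Prop := ∃ Δ : Set L, IsMChain Δ

end Lattices

/-! ## Central arrangements -/

section Arrangements

universe u v

variable {K : Type u} [Field K] {V : Type v} [AddCommGroup V] [Module K V]

/-- A central hyperplane arrangement: a finite set of linear hyperplanes
(maximal proper subspaces). -/
def IsCentralArrangement (A : Set (Submodule K V)) : Prop :=
  A.Finite ∧ ∀ H ∈ A, IsCoatom H

/-- The intersection lattice `L(A)`: all intersections of members of `A`, where the empty
intersection is the whole space `V`. It is ordered by reverse inclusion, see the instances below. -/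
def IntersectionLattice (A : Set (Submodule K V)) : Type v :=
  {X : Submodule K V // ∃ B ⊆ A, X = sInf B}

namespace IntersectionLattice

variable {A : Set (Submodule K V)}

instance : PartialOrder (IntersectionLattice A) where
  le X Y := Y.1 ≤ X.1
  le_refl X := le_refl X.1
  le_trans X Y Z h h' := le_trans h' h
  le_antisymm X Y h h' := Subtype.ext (le_antisymm h' h)

/-- The join of `X` and `Y` is the subspace `X ∩ Y`; their meet is the intersection of all
hyperplanes of `A` that contain both `X` and `Y`. -/
instance : Lattice (IntersectionLattice A) where
  sup X Y := ⟨X.1 ⊓ Y.1, by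
    obtain ⟨B, hB, hX⟩ := X.2
    obtain ⟨C, hC, hY⟩ := Y.2
    exact ⟨B ∪ C, Set.union_subset hB hC, by rw [hX, hY, sInf_union]⟩⟩
  inf X Y := ⟨sInf {H | H ∈ A ∧ X.1 ≤ H ∧ Y.1 ≤ H}, _, fun _ hH => hH.1, rfl⟩
  le_sup_left X Y := (inf_le_left : X.1 ⊓ Y.1 ≤ X.1)
  le_sup_right X Y := (inf_le_right : X.1 ⊓ Y.1 ≤ Y.1)
  sup_le X Y Z h h' := (le_inf h h' : Z.1 ≤ X.1 ⊓ Y.1)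
  inf_le_left X Y := (le_sInf fun _ hH => hH.2.1 : X.1 ≤ sInf {H | H ∈ A ∧ X.1 ≤ H ∧ Y.1 ≤ H})
  inf_le_right X Y := (le_sInf fun _ hH => hH.2.2 : Y.1 ≤ sInf {H | H ∈ A ∧ X.1 ≤ H ∧ Y.1 ≤ H})
  le_inf X Y Z h h' := by
    change sInf {H | H ∈ A ∧ Y.1 ≤ H ∧ Z.1 ≤ H} ≤ X.1
    obtain ⟨B, hB, hX⟩ := X.2
    have h1 : Y.1 ≤ sInf B := hX ▸ h
    have h2 : Z.1 ≤ sInf B := hX ▸ h'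
    rw [hX]
    exact sInf_le_sInf fun H hH => ⟨hB hH, h1.trans (sInf_le hH), h2.trans (sInf_le hH)⟩

end IntersectionLattice

/-- A central arrangement is supersolvable if its intersection lattice is. -/
def IsSupersolvable (A : Set (Submodule K V)) : Prop :=
  IsSupersolvableLattice (IntersectionLattice A)

variable (K V) in
/-- `S`, the symmetric algebra of the dual space `V*`. -/
abbrev PolyFun : Type (max u v) := SymmetricAlgebra K (Module.Dual K V)

variable (K V) in
/-- `Der(S)`, the `S`-module of `K`-linear derivations of `S`. -/
abbrev Der : Type (max u v) := Derivation K (PolyFun K V) (PolyFun K V)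

/-- A linear form on `V`, as an element of `S`. -/
abbrev linForm (α : Module.Dual K V) : PolyFun K V := SymmetricAlgebra.ι K (Module.Dual K V) α

/-- The module `D(A)` of logarithmic derivations: those `θ` with `θ(α) ∈ α S` for every linear
form `α` whose kernel is a hyperplane of `A`. -/
def logDer (A : Set (Submodule K V)) : Submodule (PolyFun K V) (Der K V) where
  carrier := {θ | ∀ α : Module.Dual K V, LinearMap.ker α ∈ A → linForm α ∣ θ (linForm α)}
  add_mem' {θ η} hθ hη α hα := by
    rw [Derivation.add_apply]
    exact dvd_add (hθ α hα) (hη α hα)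
  zero_mem' α _ := by
    rw [Derivation.zero_apply]
    exact dvd_zero _
  smul_mem' f θ hθ α hα := by
    rw [Derivation.smul_apply, smul_eq_mul]
    exact Dvd.dvd.mul_left (hθ α hα) f

/-- A central arrangement is free if `D(A)` is a free `S`-module. -/
def IsFreeArrangement (A : Set (Submodule K V)) : Prop :=
  Module.Free (PolyFun K V) (logDer A)

/-- A derivation is homogeneous of (polynomial) degree `d` if it maps linear forms into the
degree `d` part of `S`, the `d`-th power of the subspace of linear forms. -/
def IsHomogeneousDer (θ : Der K V) (d : ℕ) : Prop :=
  ∀ α : Module.Dual K V,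
    θ (linForm α) ∈ (LinearMap.range (SymmetricAlgebra.ι K (Module.Dual K V))) ^ d

/-- `m` is the multiset of exponents of `A`: the `S`-module `D(A)` has a finite basis of
homogeneous derivations, whose degrees make up `m`. -/
def HasExponents (A : Set (Submodule K V)) (m : Multiset ℕ) : Prop :=
  ∃ (n : ℕ) (b : Module.Basis (Fin n) (PolyFun K V) (logDer A)) (d : Fin n → ℕ),
    (∀ i, IsHomogeneousDer (b i : Der K V) (d i)) ∧ m = Finset.univ.val.map d

/-- The restriction `A'' = {H' ∩ H | H' ∈ A, H' ≠ H}`, an arrangement in the space `H`. -/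
def restriction (A : Set (Submodule K V)) (H : Submodule K V) : Set (Submodule K H) :=
  {X | ∃ H' ∈ A \ {H}, X = H'.comap H.subtype}

/-- Inductively free arrangements: the empty arrangement (in any space) is inductively free, and
`A` is so if for some `H ∈ A` both `A' = A \ {H}` and the restriction `A''` to `H` are
inductively free and `exp A'' ⊆ exp A'` as multisets. -/
inductive IsInductivelyFree :
    ∀ {V : Type v} [AddCommGroup V] [Module K V], Set (Submodule K V) → Prop
  | empty {V : Type v} [AddCommGroup V] [Module K V] :
      IsInductivelyFree (∅ : Set (Submodule K V))
  | add {V : Type v} [AddCommGroup V] [Module K V] (A : Set (Submodule K V))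
      (H : Submodule K V) (hH : H ∈ A)
      (h' : IsInductivelyFree (A \ {H})) (h'' : IsInductivelyFree (restriction A H))
      (m' m'' : Multiset ℕ) (hm' : HasExponents (A \ {H}) m')
      (hm'' : HasExponents (restriction A H) m'') (hle : m'' ≤ m') :
      IsInductivelyFree A

/-! ## Affine arrangements and cones -/

/-- The affine hyperplane `{α = k}` (for a nonzero linear form `α`). -/
def affHyperplane (α : Module.Dual K V) (k : K) : Set V := {v | α v = k}

/-- The cone, in `V × K` with `z` the last coordinate, over an affine arrangement `A` in `V`: it
consists of `{z = 0}` and of `{α - k z = 0}` for the hyperplanes `{α = k}` in `A`. -/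
def cone (A : Set (Set V)) : Set (Submodule K (V × K)) :=
  {LinearMap.ker (LinearMap.snd K V K)} ∪
    {H | ∃ (α : Module.Dual K V) (k : K), α ≠ 0 ∧ affHyperplane α k ∈ A ∧
      H = LinearMap.ker (α ∘ₗ LinearMap.fst K V K - k • LinearMap.snd K V K)}

end Arrangements

/-! ## The `N`-Ish arrangement -/

section NIsh

universe u

variable {K : Type u} [Field K] {ℓ : ℕ}

/-- The coordinate function `x_i` on `K^ℓ`, `1 ≤ i ≤ ℓ`. -/
def coord (i : Set.Icc 1 ℓ) : Module.Dual K (Set.Icc 1 ℓ → K) := LinearMap.proj i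

/-- The coordinate function `x_1`; it makes sense as soon as there is an index `2 ≤ j ≤ ℓ`. -/
def xOne (j : Set.Icc 2 ℓ) : Module.Dual K (Set.Icc 1 ℓ → K) :=
  coord ⟨1, Set.mem_Icc.2 ⟨le_refl 1, le_trans (le_trans one_le_two j.2.1) j.2.2⟩⟩

/-- The coordinate function `x_j` for `2 ≤ j ≤ ℓ`. -/
def xTail (j : Set.Icc 2 ℓ) : Module.Dual K (Set.Icc 1 ℓ → K) :=
  coord ⟨j.1, Set.mem_Icc.2 ⟨le_trans one_le_two j.2.1, j.2.2⟩⟩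

/-- The `N`-Ish arrangement in `K^ℓ`, for `N = (N_2, …, N_ℓ)`: the affine hyperplanes
`x_1 - x_j = a` for `2 ≤ j ≤ ℓ`, `a ∈ N_j`, and `x_i - x_j = 0` for `2 ≤ i < j ≤ ℓ`. -/
def nIsh (N : Set.Icc 2 ℓ → Finset K) : Set (Set (Set.Icc 1 ℓ → K)) :=
  {H | ∃ j, ∃ a ∈ N j, H = affHyperplane (xOne j - xTail j) a} ∪
    {H | ∃ i j : Set.Icc 2 ℓ, i < j ∧ H = affHyperplane (xTail i - xTail j) (0 : K)}

/-- `I_N`, the cone over the `N`-Ish arrangement. -/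
def coneNIsh (N : Set.Icc 2 ℓ → Finset K) : Set (Submodule K ((Set.Icc 1 ℓ → K) × K)) :=
  cone (nIsh N)

/-- `N` is a nest: `N_{w(2)} ⊆ N_{w(3)} ⊆ ⋯ ⊆ N_{w(ℓ)}` for some permutation `w` of
`{2, …, ℓ}`. -/
def IsNest (N : Set.Icc 2 ℓ → Finset K) : Prop :=
  ∃ w : Equiv.Perm (Set.Icc 2 ℓ), ∀ i j, i ≤ j → N (w i) ⊆ N (w j)

end NIsh

/-! ## The notions apply to `I_N`: well-definedness facts -/

section ArrangementFacts

universe u v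

variable {K : Type u} [Field K] {V : Type v} [AddCommGroup V] [Module K V]

theorem IsCentralArrangement.delete {A : Set (Submodule K V)} (hA : IsCentralArrangement A)
    (H : Submodule K V) : IsCentralArrangement (A \ {H}) :=
  ⟨hA.1.subset Set.sdiff_subset, fun X hX => hA.2 X hX.1⟩

theorem IsCentralArrangement.restrict {A : Set (Submodule K V)} (hA : IsCentralArrangement A)
    {H : Submodule K V} (hH : H ∈ A) : IsCentralArrangement (restriction A H) := by
  refine ⟨(hA.1.image fun H' => H'.comap H.subtype).subset ?_, ?_⟩
  · rintro X ⟨H', hH', rfl⟩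
    exact ⟨H', hH'.1, rfl⟩
  · rintro X ⟨H', ⟨hH', hne⟩, rfl⟩
    have hc := hA.2 H' hH'
    have hd := hA.2 H hH
    have hcov : H' ⊓ H ⋖ H := by
      have h1 : H' ⋖ H' ⊔ H := by
        rw [hc.sup_eq_top_of_ne hd hne]
        exact covBy_top_iff.2 hc
      exact inf_covBy_of_covBy_sup_left h1
    constructor
    · intro htop
      have : H ≤ H' := by
        intro x hx
        have : (⟨x, hx⟩ : H) ∈ H'.comap H.subtype := by rw [htop]; trivial
        exact this
      exact hcov.lt.ne (inf_eq_right.2 this)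
    · intro Y hY
      have h2 : H' ⊓ H < Y.map H.subtype := by
        have := (Submodule.map_strictMono_of_injective (f := H.subtype) H.injective_subtype) hY
        rwa [Submodule.map_comap_subtype, inf_comm] at this
      have h3 : Y.map H.subtype = H := by
        by_contra hn
        exact hcov.2 h2 (lt_of_le_of_ne (Submodule.map_subtype_le H Y) hn)
      apply Submodule.map_injective_of_injective H.injective_subtype
      rw [h3, Submodule.map_top, Submodule.range_subtype]

/-- The hyperplane `{α - k z = 0}` of the cone depends only on the affine hyperplane
`{α = k}`. -/
theorem ker_cone_eq_of_affHyperplane_eq {α β : Module.Dual K V} {k m : K} (hβ : β ≠ 0)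
    (h : affHyperplane α k = affHyperplane β m) :
    LinearMap.ker (α ∘ₗ LinearMap.fst K V K - k • LinearMap.snd K V K) =
      LinearMap.ker (β ∘ₗ LinearMap.fst K V K - m • LinearMap.snd K V K) := by
  obtain ⟨v, hv⟩ := LinearMap.surjective hβ m
  have hv' : α v = k := by
    have : v ∈ affHyperplane β m := hv
    rw [← h] at this; exact this
  have hker : ∀ w, β w = 0 ↔ α w = 0 := by
    intro w
    have : v + w ∈ affHyperplane β m ↔ v + w ∈ affHyperplane α k := by rw [h]
    simpa [affHyperplane, hv, hv'] using this
  ext ⟨x, t⟩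
  have := hker (x - t • v)
  simp only [map_sub, map_smul, hv, hv', smul_eq_mul] at this
  simp only [LinearMap.mem_ker, LinearMap.sub_apply, LinearMap.comp_apply, LinearMap.fst_apply,
    LinearMap.smul_apply, LinearMap.snd_apply, smul_eq_mul]
  rw [mul_comm k, mul_comm m]
  exact this.symm

end ArrangementFacts

section NIshFacts

universe u

variable {K : Type u} [Field K] {ℓ : ℕ}

theorem xOne_sub_xTail_ne (j : Set.Icc 2 ℓ) : (xOne j - xTail j : Module.Dual K _) ≠ 0 := by
  intro h
  have := LinearMap.congr_fun h
    (Pi.single ⟨1, Set.mem_Icc.2 ⟨le_refl 1, le_trans (le_trans one_le_two j.2.1) j.2.2⟩⟩ 1)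
  have hj : (j:ℕ) ≠ 1 := by have := j.2.1; omega
  simp [xOne, xTail, coord, Pi.single_apply] at this
  rw [if_neg hj] at this
  simp at this

theorem xTail_sub_xTail_ne {i j : Set.Icc 2 ℓ} (hij : i < j) :
    (xTail i - xTail j : Module.Dual K _) ≠ 0 := by
  intro h
  have := LinearMap.congr_fun h (Pi.single ⟨i.1, Set.mem_Icc.2 ⟨le_trans one_le_two i.2.1, i.2.2⟩⟩ 1)
  have hj : (j:ℕ) ≠ i := by have : (i:ℕ) < j := hij; omega
  simp [xTail, coord, Pi.single_apply] at this
  rw [if_neg hj] at this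
  simp at this

/-- Explicitly, the members of `I_N` are the hyperplanes `z = 0`, `x_1 - x_j = a z` (`a ∈ N_j`)
and `x_i - x_j = 0` (`2 ≤ i < j ≤ ℓ`). -/
theorem mem_coneNIsh_iff (N : Set.Icc 2 ℓ → Finset K)
    (H : Submodule K ((Set.Icc 1 ℓ → K) × K)) :
    H ∈ coneNIsh N ↔
      H = LinearMap.ker (LinearMap.snd K (Set.Icc 1 ℓ → K) K) ∨
      (∃ j, ∃ a ∈ N j, H = LinearMap.ker
        ((xOne j - xTail j) ∘ₗ LinearMap.fst K _ K - a • LinearMap.snd K _ K)) ∨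
      ∃ i j : Set.Icc 2 ℓ, i < j ∧ H = LinearMap.ker
        ((xTail i - xTail j) ∘ₗ LinearMap.fst K (Set.Icc 1 ℓ → K) K) := by
  constructor
  · rintro (h | ⟨α, k, hα, ⟨j, a, ha, h⟩ | ⟨i, j, hij, h⟩, rfl⟩)
    · exact Or.inl h
    · exact Or.inr (Or.inl ⟨j, a, ha, ker_cone_eq_of_affHyperplane_eq (xOne_sub_xTail_ne j) h⟩)
    · refine Or.inr (Or.inr ⟨i, j, hij, ?_⟩)
      rw [ker_cone_eq_of_affHyperplane_eq (xTail_sub_xTail_ne hij) h, zero_smul, sub_zero]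
  · rintro (h | ⟨j, a, ha, rfl⟩ | ⟨i, j, hij, rfl⟩)
    · exact Or.inl h
    · exact Or.inr ⟨_, a, xOne_sub_xTail_ne j, Or.inl ⟨j, a, ha, rfl⟩, rfl⟩
    · exact Or.inr ⟨_, 0, xTail_sub_xTail_ne hij, Or.inr ⟨i, j, hij, rfl⟩, by
        rw [zero_smul, sub_zero]⟩

theorem isCentralArrangement_coneNIsh (N : Set.Icc 2 ℓ → Finset K) :
    IsCentralArrangement (coneNIsh N) := by
  constructor
  · refine Set.Finite.subset (Set.Finite.union (Set.finite_singleton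
      (LinearMap.ker (LinearMap.snd K (Set.Icc 1 ℓ → K) K))) (Set.Finite.union
      (Set.finite_iUnion fun j : Set.Icc 2 ℓ => (N j).finite_toSet.image fun a => LinearMap.ker
        ((xOne j - xTail j) ∘ₗ LinearMap.fst K _ K - a • LinearMap.snd K _ K))
      (Set.finite_range fun p : Set.Icc 2 ℓ × Set.Icc 2 ℓ => LinearMap.ker
        ((xTail p.1 - xTail p.2) ∘ₗ LinearMap.fst K (Set.Icc 1 ℓ → K) K)))) ?_
    intro H hH
    rcases (mem_coneNIsh_iff N H).1 hH with h | ⟨j, a, ha, h⟩ | ⟨i, j, -, h⟩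
    · exact Or.inl h
    · exact Or.inr (Or.inl (Set.mem_iUnion.2 ⟨j, a, ha, h.symm⟩))
    · exact Or.inr (Or.inr ⟨(i, j), h.symm⟩)
  · rintro H (h | ⟨α, k, hα, -, rfl⟩)
    · rw [h]
      refine LinearMap.isCoatom_ker_of_surjective (LinearMap.surjective ?_)
      intro h0
      simpa using LinearMap.congr_fun h0 (0, 1)
    · refine LinearMap.isCoatom_ker_of_surjective (LinearMap.surjective ?_)
      intro h0
      apply hα
      refine LinearMap.ext fun v => ?_
      simpa using LinearMap.congr_fun h0 (v, 0)
end NIshFacts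

/-! The implications form a cycle 1 → 2 → 3 → 4 → 1, and the pivot is the notion of modular levels
(`HasModularLevels`): the hyperplanes are graded so that two of equal level always meet inside one
of lower level, while the flat cut out by all lower levels is never contained in the hyperplane.
Picking one hyperplane per level then behaves like picking basis vectors.

For a nest, order the indices from the largest $N_j$ to the smallest and grade a hyperplane by the
last $x_j$ that it involves. The only delicate pair is $x_1-x_j=az$ and $x_j=x_m$ with $m$ before
$j$: it lies in $x_1-x_m=az$, which belongs to the arrangement because $N_j\subseteq N_m$. Modular
levels give an M-chain (`HasModularLevels.isSupersolvable`): the lattice generated by the flats of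
the levels and any chain embeds in the lattice of finite sets of levels. Conversely an M-chain
grades the atoms by the place where they enter it (`IsMChain.hasModularLevels`).

Given modular levels, delete a hyperplane $H$ of top level. Deletion and restriction again have
modular levels, and restriction to $H$ identifies the hyperplanes of lower level with those of the
restriction. The exponents are the sizes of the levels, and Terao's addition theorem
(`HasExponents.addition`) carries the induction. The same theorem gives 3 → 4.

For 4 → 1, suppose $N_i$ and $N_j$ are incomparable. By Saito's criterion (`exists_det_eq`) the
coefficient determinant of a basis of $D(\mathcal A)$ is a unit times the defining polynomial. At a
point lying on only the hyperplanes that involve $x_1,x_i,x_j,z$, divisibility lets the forms of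
these hyperplanes be extracted from three columns (`exists_decomposition`), and by incomparability
the remaining cofactor vanishes at that point (`exists_det_eq_mul`). The determinant thus vanishes
there to too high an order, a contradiction. -/

/-! ### Polynomial functions, derivations, restriction to subspaces, homogeneity. -/

section SymmetricAlgebraFacts

open Polynomial

universe u v

variable {K : Type u} [Field K] {V : Type v} [AddCommGroup V] [Module K V]

/-- Evaluation of polynomial functions at a point. -/
noncomputable def evalPoint (p : V) : PolyFun K V →ₐ[K] K :=
  SymmetricAlgebra.lift (Module.Dual.eval K V p)

theorem evalPoint_linForm (p : V) (α : Module.Dual K V) : evalPoint p (linForm α) = α p := by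
  simp [evalPoint]

theorem linForm_eq_zero {α : Module.Dual K V} (h : linForm α = 0) : α = 0 := by
  ext p
  rw [← evalPoint_linForm, h]
  simp

theorem ker_le_ker_of_linForm_dvd {α β : Module.Dual K V} (h : linForm α ∣ linForm β) :
    LinearMap.ker α ≤ LinearMap.ker β := by
  intro p hp
  rw [LinearMap.mem_ker] at hp ⊢
  obtain ⟨c, hc⟩ := h
  rw [← evalPoint_linForm, hc, map_mul, evalPoint_linForm, hp, zero_mul]

theorem exists_smul_eq_of_ker_le {α β : Module.Dual K V}
    (h : LinearMap.ker α ≤ LinearMap.ker β) : ∃ c : K, β = c • α := by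
  have := mem_span_of_iInf_ker_le_ker (ι := Unit) (L := fun _ => α) (K := β) (by simpa using h)
  rw [Set.range_const, Submodule.mem_span_singleton] at this
  obtain ⟨c, hc⟩ := this
  exact ⟨c, hc.symm⟩

theorem exists_ker_eq_of_isCoatom {H : Submodule K V} (hH : IsCoatom H) :
    ∃ α : Module.Dual K V, LinearMap.ker α = H := by
  obtain ⟨f, hf, hle⟩ := Submodule.exists_le_ker_of_lt_top H hH.lt_top
  refine ⟨f, ((hH.le_iff.1 hle).resolve_left ?_)⟩
  rwa [LinearMap.ker_eq_top]

theorem ne_zero_of_isCoatom_ker {α : Module.Dual K V} (hH : IsCoatom (LinearMap.ker α)) :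
    α ≠ 0 := by
  rintro rfl
  exact hH.1 LinearMap.ker_zero

theorem polyFun_uniqueFactorizationMonoid : UniqueFactorizationMonoid (PolyFun K V) :=
  let ⟨⟨_, b⟩⟩ := Module.Free.exists_basis (R := K) (M := Module.Dual K V)
  (SymmetricAlgebra.equivMvPolynomial b).symm.toMulEquiv.uniqueFactorizationMonoid
    inferInstance

/-! ### Derivations -/

theorem der_ext {A : Type*} [CommRing A] [Algebra K A] [Module (PolyFun K V) A]
    [IsScalarTower K (PolyFun K V) A] {θ η : Derivation K (PolyFun K V) A}
    (h : ∀ α : Module.Dual K V, θ (linForm α) = η (linForm α)) : θ = η := by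
  ext f
  induction f using SymmetricAlgebra.induction with
  | algebraMap r => simp
  | ι x => exact h x
  | mul a b ha hb => simp [ha, hb]
  | add a b ha hb => simp [ha, hb]

/-- The derivation with prescribed values on linear forms. -/
theorem exists_der (f : Module.Dual K V →ₗ[K] PolyFun K V) :
    ∃ θ : Der K V, ∀ α, θ (linForm α) = f α := by
  obtain ⟨⟨κ, b⟩⟩ := Module.Free.exists_basis (R := K) (M := Module.Dual K V)
  let e := SymmetricAlgebra.equivMvPolynomial b
  let D := MvPolynomial.mkDerivation K (fun i => e (f (b i)))
  let θ : Der K V := Derivation.mk' (e.symm.toLinearMap ∘ₗ D.toLinearMap ∘ₗ e.toLinearMap) (by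
    intro x y
    simp)
  refine ⟨θ, fun α => ?_⟩
  have : θ.toLinearMap ∘ₗ SymmetricAlgebra.ι K (Module.Dual K V) = f := by
    refine b.ext fun i => ?_
    change e.symm (D (e (SymmetricAlgebra.ι K _ (b i)))) = _
    rw [SymmetricAlgebra.equivMvPolynomial_ι_apply]
    simp [D]
  exact LinearMap.congr_fun this α

/-! ### Restriction to a subspace -/

/-- Restriction of polynomial functions to a subspace. -/
noncomputable def res (H : Submodule K V) : PolyFun K V →ₐ[K] PolyFun K H :=
  SymmetricAlgebra.lift (SymmetricAlgebra.ι K (Module.Dual K H) ∘ₗ H.subtype.dualMap)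

theorem res_linForm (H : Submodule K V) (α : Module.Dual K V) :
    res H (linForm α) = linForm (H.subtype.dualMap α) := by
  simp [res]

/-- A linear section of the restriction of linear forms to a subspace. -/
theorem exists_dualMap_section (H : Submodule K V) :
    ∃ σ : Module.Dual K H →ₗ[K] Module.Dual K V, ∀ γ, H.subtype.dualMap (σ γ) = γ := by
  obtain ⟨g, hg⟩ := LinearMap.exists_leftInverse_of_injective H.subtype
    (LinearMap.ker_eq_bot.2 H.injective_subtype)
  refine ⟨g.dualMap, fun γ => ?_⟩
  ext x
  have := LinearMap.congr_fun hg x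
  simp only [LinearMap.comp_apply, LinearMap.id_apply] at this
  change γ (g (H.subtype x)) = γ x
  rw [this]

/-- The extension of polynomial functions from a subspace, given by a section on linear forms. -/
noncomputable def extendBy {H : Submodule K V} (σ : Module.Dual K H →ₗ[K] Module.Dual K V) :
    PolyFun K H →ₐ[K] PolyFun K V :=
  SymmetricAlgebra.lift (SymmetricAlgebra.ι K (Module.Dual K V) ∘ₗ σ)

theorem extendBy_linForm {H : Submodule K V} (σ : Module.Dual K H →ₗ[K] Module.Dual K V)
    (γ : Module.Dual K H) : extendBy σ (linForm γ) = linForm (σ γ) := by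
  simp [extendBy]

theorem res_extendBy {H : Submodule K V} {σ : Module.Dual K H →ₗ[K] Module.Dual K V}
    (hσ : ∀ γ, H.subtype.dualMap (σ γ) = γ) (f : PolyFun K H) : res H (extendBy σ f) = f := by
  have : (res H).comp (extendBy σ) = AlgHom.id K _ := by
    apply SymmetricAlgebra.algHom_ext
    ext γ : 1
    change res H (extendBy σ (linForm γ)) = linForm γ
    rw [extendBy_linForm, res_linForm, hσ]
  exact DFunLike.congr_fun this f

theorem res_surjective (H : Submodule K V) : Function.Surjective (res H) := by
  obtain ⟨σ, hσ⟩ := exists_dualMap_section H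
  exact fun f => ⟨_, res_extendBy hσ f⟩

theorem dualMap_subtype_eq_zero_iff {H : Submodule K V} {α : Module.Dual K V} :
    H.subtype.dualMap α = 0 ↔ H ≤ LinearMap.ker α := by
  constructor
  · intro h x hx
    exact LinearMap.congr_fun h ⟨x, hx⟩
  · intro h
    ext x
    exact h x.2

theorem linForm_smul (c : K) (α : Module.Dual K V) :
    linForm (c • α) = algebraMap K (PolyFun K V) c * linForm α := by
  rw [linForm, map_smul, Algebra.smul_def]

theorem linForm_dvd_of_ker_le {α β : Module.Dual K V}
    (h : LinearMap.ker α ≤ LinearMap.ker β) : linForm α ∣ linForm β := by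
  obtain ⟨c, rfl⟩ := exists_smul_eq_of_ker_le h
  rw [linForm_smul]
  exact Dvd.intro_left _ rfl

/-- Restricting and re-extending is an algebra endomorphism of $S$ congruent to the identity modulo
$\alpha$ on linear forms, hence everywhere. -/
theorem linForm_dvd_sub_extendBy {α : Module.Dual K V}
    {σ : Module.Dual K (LinearMap.ker α) →ₗ[K] Module.Dual K V}
    (hσ : ∀ γ, (LinearMap.ker α).subtype.dualMap (σ γ) = γ) (f : PolyFun K V) :
    linForm α ∣ f - extendBy σ (res (LinearMap.ker α) f) := by
  induction f using SymmetricAlgebra.induction with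
  | algebraMap r => simp
  | ι β =>
    change linForm α ∣ linForm β - extendBy σ (res (LinearMap.ker α) (linForm β))
    rw [res_linForm, extendBy_linForm, linForm, ← map_sub]
    refine linForm_dvd_of_ker_le ?_
    rw [← dualMap_subtype_eq_zero_iff, map_sub, hσ, sub_self]
  | mul a b ha hb =>
    rw [map_mul, map_mul]
    have := dvd_add (ha.mul_right b) (hb.mul_left (extendBy σ (res (LinearMap.ker α) a)))
    convert this using 1
    ring
  | add a b ha hb =>
    rw [map_add, map_add]
    convert dvd_add ha hb using 1
    ring

theorem res_eq_zero_iff {α : Module.Dual K V} {f : PolyFun K V} :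
    res (LinearMap.ker α) f = 0 ↔ linForm α ∣ f := by
  constructor
  · intro h
    obtain ⟨σ, hσ⟩ := exists_dualMap_section (LinearMap.ker α)
    simpa [h] using linForm_dvd_sub_extendBy hσ f
  · rintro ⟨c, rfl⟩
    rw [map_mul, res_linForm, dualMap_subtype_eq_zero_iff.2 le_rfl, linForm, map_zero, zero_mul]

/-- By `res_eq_zero_iff`, $S/\alpha S$ embeds in the polynomial functions on $\ker\alpha$, a domain.
-/
theorem linForm_prime {α : Module.Dual K V} (hα : α ≠ 0) : Prime (linForm α) := by
  refine ⟨fun h => hα (linForm_eq_zero h), fun h => ?_, fun a b hab => ?_⟩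
  · have := res_eq_zero_iff.2 (h.dvd : linForm α ∣ 1)
    rw [map_one] at this
    exact one_ne_zero this
  · rw [← res_eq_zero_iff, map_mul, mul_eq_zero] at hab
    rwa [← res_eq_zero_iff, ← res_eq_zero_iff]

/-! ### Homogeneous polynomial functions -/

/-- `f ↦ ∑ f_d X ^ d`, where the `f_d` are the homogeneous components of `f`. -/
noncomputable def degreeHom : PolyFun K V →ₐ[K] (PolyFun K V)[X] :=
  SymmetricAlgebra.lift
    ((LinearMap.mulRight K (X : (PolyFun K V)[X])) ∘ₗ
      (Algebra.ofId (PolyFun K V) _ |>.restrictScalars K).toLinearMap ∘ₗ SymmetricAlgebra.ι K (Module.Dual K V))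

theorem degreeHom_linForm (α : Module.Dual K V) :
    degreeHom (linForm α) = C (linForm α) * X := by
  simp [degreeHom, Algebra.ofId_apply]

/-- Homogeneity of degree `d`. -/
def IsHomog (f : PolyFun K V) (d : ℕ) : Prop := degreeHom f = C f * X ^ d

theorem IsHomog.mul {f g : PolyFun K V} {d e : ℕ} (hf : IsHomog f d) (hg : IsHomog g e) :
    IsHomog (f * g) (d + e) := by
  unfold IsHomog at *
  rw [map_mul, hf, hg, C_mul]; ring

theorem IsHomog.add {f g : PolyFun K V} {d : ℕ} (hf : IsHomog f d) (hg : IsHomog g d) :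
    IsHomog (f + g) d := by
  unfold IsHomog at *
  rw [map_add, hf, hg, C_add]; ring

theorem isHomog_zero (d : ℕ) : IsHomog (0 : PolyFun K V) d := by
  simp [IsHomog]

theorem isHomog_algebraMap (c : K) : IsHomog (algebraMap K (PolyFun K V) c) 0 := by
  unfold IsHomog
  rw [AlgHom.commutes, pow_zero, mul_one]
  rfl

theorem isHomog_one : IsHomog (1 : PolyFun K V) 0 := by
  simpa using isHomog_algebraMap (V := V) (1 : K)

theorem isHomog_linForm (α : Module.Dual K V) : IsHomog (linForm α) 1 := by
  simp [IsHomog, degreeHom_linForm]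

theorem IsHomog.pow {f : PolyFun K V} {d : ℕ} (hf : IsHomog f d) (n : ℕ) :
    IsHomog (f ^ n) (n * d) := by
  unfold IsHomog at *
  rw [map_pow, hf, mul_pow, C_pow, ← pow_mul, mul_comm d]

theorem isHomog_prod {ι : Type*} (s : Finset ι) {f : ι → PolyFun K V} {d : ι → ℕ}
    (h : ∀ i ∈ s, IsHomog (f i) (d i)) : IsHomog (∏ i ∈ s, f i) (∑ i ∈ s, d i) := by
  unfold IsHomog at *
  rw [map_prod, Finset.prod_congr rfl h, Finset.prod_mul_distrib, map_prod,
    Finset.prod_pow_eq_pow_sum]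

theorem isHomog_of_mem_pow {f : PolyFun K V} {d : ℕ}
    (h : f ∈ LinearMap.range (SymmetricAlgebra.ι K (Module.Dual K V)) ^ d) : IsHomog f d := by
  induction d generalizing f with
  | zero =>
    rw [pow_zero, Submodule.mem_one] at h
    obtain ⟨c, rfl⟩ := h
    exact isHomog_algebraMap c
  | succ d ih =>
    rw [pow_succ] at h
    induction h using Submodule.mul_induction_on' with
    | mem_mul_mem a ha b hb =>
      obtain ⟨β, rfl⟩ := hb
      exact (ih ha).mul (isHomog_linForm β)
    | add a _ b _ ha hb => exact ha.add hb

theorem eval_one_degreeHom (f : PolyFun K V) : (degreeHom f).eval 1 = f := by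
  have : ((Polynomial.aeval (R := PolyFun K V) (1 : PolyFun K V)).restrictScalars K).comp
      degreeHom = AlgHom.id K _ := by
    apply SymmetricAlgebra.algHom_ext
    ext α : 1
    change Polynomial.aeval (1 : PolyFun K V) (degreeHom (linForm α)) = linForm α
    rw [degreeHom_linForm]
    simp
  have h := DFunLike.congr_fun this f
  change Polynomial.aeval (1 : PolyFun K V) (degreeHom f) = f at h
  rwa [Polynomial.coe_aeval_eq_eval] at h

/-- Links the two descriptions of homogeneity: the coefficient of $X^d$ is the degree $d$ component,
so `IsHomog` agrees with membership in the $d$-th power of the space of linear forms. -/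
theorem coeff_degreeHom_mem (f : PolyFun K V) (d : ℕ) :
    (degreeHom f).coeff d ∈ LinearMap.range (SymmetricAlgebra.ι K (Module.Dual K V)) ^ d := by
  induction f using SymmetricAlgebra.induction generalizing d with
  | algebraMap r =>
    rw [AlgHom.commutes, Polynomial.algebraMap_apply, coeff_C]
    split_ifs with h
    · rw [h, pow_zero]
      exact Submodule.mem_one.2 ⟨r, rfl⟩
    · exact zero_mem _
  | ι α =>
    change (degreeHom (linForm α)).coeff d ∈ _
    rw [degreeHom_linForm, coeff_C_mul, coeff_X]
    split_ifs with h
    · rw [← h, pow_one, mul_one]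
      exact ⟨α, rfl⟩
    · rw [mul_zero]; exact zero_mem _
  | mul a b ha hb =>
    rw [map_mul, coeff_mul]
    refine sum_mem fun x hx => ?_
    rw [← Finset.HasAntidiagonal.mem_antidiagonal.1 hx, pow_add]
    exact Submodule.mul_mem_mul (ha _) (hb _)
  | add a b ha hb =>
    rw [map_add, coeff_add]
    exact add_mem (ha d) (hb d)

theorem isHomog_iff_mem_pow {f : PolyFun K V} {d : ℕ} :
    IsHomog f d ↔ f ∈ LinearMap.range (SymmetricAlgebra.ι K (Module.Dual K V)) ^ d := by
  refine ⟨fun h => ?_, isHomog_of_mem_pow⟩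
  have := coeff_degreeHom_mem f d
  rwa [h, coeff_C_mul, coeff_X_pow_self, mul_one] at this

theorem isHomogeneousDer_iff {θ : Der K V} {d : ℕ} :
    IsHomogeneousDer θ d ↔ ∀ α, IsHomog (θ (linForm α)) d := by
  simp only [isHomog_iff_mem_pow]; rfl

theorem IsHomog.sub {f g : PolyFun K V} {d : ℕ} (hf : IsHomog f d) (hg : IsHomog g d) :
    IsHomog (f - g) d := by
  unfold IsHomog at *
  rw [map_sub, hf, hg, C_sub]; ring

theorem degreeHom_injective : Function.Injective (degreeHom : PolyFun K V → (PolyFun K V)[X]) :=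
  fun f g h => by rw [← eval_one_degreeHom f, h, eval_one_degreeHom]

/-- A cofactor of homogeneous polynomial functions is homogeneous. -/
theorem IsHomog.of_mul_left {f g : PolyFun K V} {d e : ℕ} (hf : IsHomog f d) (h0 : f ≠ 0)
    (hfg : IsHomog (f * g) e) : (g = 0 ∨ d ≤ e) ∧ IsHomog g (e - d) := by
  unfold IsHomog at *
  have h : X ^ d * degreeHom g = C g * X ^ e := by
    have hC : (C f : (PolyFun K V)[X]) ≠ 0 := by simpa using h0
    apply mul_left_cancel₀ hC
    rw [map_mul, hf, C_mul] at hfg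
    rw [← mul_assoc, hfg, mul_assoc]
  rcases eq_or_ne g 0 with rfl | hg
  · simp
  have hde : d ≤ e := by
    have h1 := congrArg natDegree h
    have hg' : degreeHom g ≠ 0 := fun h' => hg (degreeHom_injective (by rw [h', map_zero]))
    rw [natDegree_C_mul_X_pow _ _ hg, natDegree_mul (pow_ne_zero _ X_ne_zero) hg',
      natDegree_X_pow] at h1
    omega
  refine ⟨Or.inr hde, mul_left_cancel₀ (pow_ne_zero d X_ne_zero) ?_⟩
  rw [h, mul_left_comm, ← pow_add, Nat.add_sub_cancel' hde]

theorem IsHomog.exists_algebraMap {f : PolyFun K V} (hf : IsHomog f 0) :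
    ∃ c : K, algebraMap K _ c = f := by
  rw [isHomog_iff_mem_pow, pow_zero, Submodule.mem_one] at hf
  exact hf

theorem IsHomog.res {f : PolyFun K V} {d : ℕ} (hf : IsHomog f d) (H : Submodule K V) :
    IsHomog (res H f) d := by
  rw [isHomog_iff_mem_pow] at *
  have hle : (LinearMap.range (SymmetricAlgebra.ι K (Module.Dual K V))).map
      (_root_.res H).toLinearMap ≤ LinearMap.range (SymmetricAlgebra.ι K (Module.Dual K H)) := by
    rintro _ ⟨_, ⟨α, rfl⟩, rfl⟩
    exact ⟨_, (res_linForm H α).symm⟩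
  have := Submodule.mem_map_of_mem (f := (_root_.res H).toLinearMap) hf
  rw [Submodule.map_pow] at this
  exact SetLike.le_def.1 (pow_le_pow_left' hle d) this

theorem IsHomog.extendBy {H : Submodule K V} {f : PolyFun K H} {d : ℕ} (hf : IsHomog f d)
    (σ : Module.Dual K H →ₗ[K] Module.Dual K V) : IsHomog (extendBy σ f) d := by
  rw [isHomog_iff_mem_pow] at *
  have hle : (LinearMap.range (SymmetricAlgebra.ι K (Module.Dual K H))).map
      (_root_.extendBy σ).toLinearMap ≤ LinearMap.range (SymmetricAlgebra.ι K (Module.Dual K V)) := by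
    rintro _ ⟨_, ⟨α, rfl⟩, rfl⟩
    exact ⟨_, (extendBy_linForm σ α).symm⟩
  have := Submodule.mem_map_of_mem (f := (_root_.extendBy σ).toLinearMap) hf
  rw [Submodule.map_pow] at this
  exact SetLike.le_def.1 (pow_le_pow_left' hle d) this

end SymmetricAlgebraFacts

/-! ### Modular levels and supersolvability. -/

section ModularLevels

universe u v

variable {K : Type u} [Field K] {V : Type v} [AddCommGroup V] [Module K V]

/-- A level function on an arrangement that exhibits it as an iterated modular extension: two
hyperplanes of the same level meet inside a hyperplane of lower level, and no hyperplane contains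
the intersection of the hyperplanes of lower level. -/
structure HasModularLevels (A : Set (Submodule K V)) (ρ : Submodule K V → ℕ) : Prop where
  exists_lower : ∀ H ∈ A, ∀ H' ∈ A, H ≠ H' → ρ H = ρ H' → ∃ H'' ∈ A, ρ H'' < ρ H ∧ H ⊓ H' ≤ H''
  not_sInf_le : ∀ H ∈ A, ¬ sInf {H' | H' ∈ A ∧ ρ H' < ρ H} ≤ H

theorem inf_covBy_of_isCoatom {H W : Submodule K V} (hH : IsCoatom H) (h : ¬ W ≤ H) :
    W ⊓ H ⋖ W := by
  apply inf_covBy_of_covBy_sup_right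
  have : H < W ⊔ H := lt_of_le_of_ne le_sup_right fun h' => h (h' ▸ le_sup_left)
  rw [hH.2 _ this]
  exact covBy_top_iff.2 hH

/-- Inside $G$ both intersections are hyperplanes, so containment of one in the other forces
equality. -/
theorem inf_eq_inf_of_isCoatom {H H' G : Submodule K V} (hH : IsCoatom H) (hH' : IsCoatom H')
    (hG : IsCoatom G) (h1 : G ≠ H) (h2 : G ≠ H') (hle : H ⊓ G ≤ H') : H' ⊓ G = H ⊓ G := by
  have hc : G ⊓ H ⋖ G := inf_covBy_of_isCoatom hH fun h => h1 (hG.le_iff.1 h |>.resolve_left hH.1).symm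
  have h3 : ¬ G ≤ H' := fun h => h2 (hG.le_iff.1 h |>.resolve_left hH'.1).symm
  rw [inf_comm H, inf_comm H']
  rw [inf_comm] at hle
  rcases hc.eq_or_eq (le_inf inf_le_left hle) inf_le_left with h | h
  · exact h
  · exact absurd (inf_eq_left.1 h) h3

variable {A : Set (Submodule K V)} {ρ : Submodule K V → ℕ}

namespace HasModularLevels

/-- Independence of a transversal, by induction on the largest level $e$ of $E$. If $H$ has level
above $e$, the flat below it would already lie in $H$. If it has level below $e$, then $h_e$ cannot
be what forces containment in $H$, as otherwise the flat below $e$ would lie in $h_e$; so $h_e$ can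
be dropped. -/
theorem level_mem_of_inf_le (hA : IsCentralArrangement A) (hρ : HasModularLevels A ρ)
    {h : ℕ → Submodule K V} {E : Finset ℕ} (hE : ∀ k ∈ E, h k ∈ A ∧ ρ (h k) = k)
    {H : Submodule K V} (hH : H ∈ A) (hle : E.inf h ≤ H) : ρ H ∈ E := by
  induction E using Finset.induction_on_max with
  | empty =>
    rw [Finset.inf_empty] at hle
    exact absurd (top_le_iff.1 hle) (hA.2 H hH).1
  | insert e E hmax ih =>
    have hsInf : ∀ m, (∀ k ∈ E, k < m) → sInf {H' | H' ∈ A ∧ ρ H' < m} ≤ E.inf h := by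
      intro m hm
      refine Finset.le_inf fun k hk => sInf_le ?_
      have := hE k (Finset.mem_insert_of_mem hk)
      exact ⟨this.1, this.2.symm ▸ hm k hk⟩
    obtain ⟨heA, hel⟩ := hE e (Finset.mem_insert_self _ _)
    rw [Finset.inf_insert] at hle
    rcases lt_trichotomy (ρ H) e with hlt | heq | hgt
    · refine Finset.mem_insert_of_mem (ih (fun k hk => hE k (Finset.mem_insert_of_mem hk)) ?_)
      by_contra hn
      have hWe : ¬ E.inf h ≤ h e := fun h' =>
        hρ.not_sInf_le _ heA ((hsInf _ (hel.symm ▸ hmax)).trans h')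
      have hc := inf_covBy_of_isCoatom (hA.2 _ heA) hWe
      rw [inf_comm] at hle
      rcases hc.eq_or_eq (le_inf inf_le_left hle) inf_le_left with h' | h'
      · have h3 : sInf {H' | H' ∈ A ∧ ρ H' < ρ (h e)} ≤ E.inf h ⊓ H :=
          le_inf (hsInf _ (hel.symm ▸ hmax)) (sInf_le ⟨hH, hel.symm ▸ hlt⟩)
        exact absurd (h3.trans (h'.le.trans inf_le_right)) (hρ.not_sInf_le _ heA)
      · exact hn (inf_eq_left.1 h')
    · exact heq ▸ Finset.mem_insert_self _ _
    · have h3 : sInf {H' | H' ∈ A ∧ ρ H' < ρ H} ≤ h e ⊓ E.inf h :=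
        le_inf (sInf_le ⟨heA, hel.symm ▸ hgt⟩) (hsInf _ fun k hk => (hmax k hk).trans hgt)
      exact absurd (h3.trans hle) (hρ.not_sInf_le _ hH)

/-- One hyperplane per occurring level suffices to cut out a flat: another hyperplane of the same
level meets the chosen one inside a hyperplane of lower level, which is covered by induction and
spans the same pencil. -/
theorem eq_inf (hA : IsCentralArrangement A) (hρ : HasModularLevels A ρ)
    {h : ℕ → Submodule K V} {E : Finset ℕ} {y : Submodule K V} (hy : ∃ B ⊆ A, y = sInf B)
    (hyE : ∀ H ∈ A, y ≤ H → ρ H ∈ E) (hE : ∀ k ∈ E, h k ∈ A ∧ ρ (h k) = k ∧ y ≤ h k) :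
    y = E.inf h := by
  refine le_antisymm (Finset.le_inf fun k hk => (hE k hk).2.2) ?_
  have key : ∀ n, ∀ H ∈ A, y ≤ H → ρ H = n → E.inf h ≤ H := by
    intro n
    induction n using Nat.strong_induction_on with
    | _ n ih =>
      intro H hH hyH hn
      obtain ⟨h1, h2, h3⟩ := hE _ (hyE H hH hyH)
      rcases eq_or_ne H (h (ρ H)) with heq | hne
      · rw [heq]; exact Finset.inf_le (hyE H hH hyH)
      · obtain ⟨H'', hH'', hlt, hle⟩ := hρ.exists_lower H hH _ h1 hne h2.symm
        have hG : h (ρ H) ≠ H'' := fun he => by rw [← he, h2] at hlt; exact lt_irrefl _ hlt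
        have := inf_eq_inf_of_isCoatom (hA.2 _ hH) (hA.2 _ hH'') (hA.2 _ h1) hne.symm hG hle
        exact (le_inf (ih _ (hn ▸ hlt) H'' hH'' ((le_inf hyH h3).trans hle) rfl)
          (Finset.inf_le (hyE H hH hyH))).trans (this.le.trans inf_le_left)
  obtain ⟨B, hB, rfl⟩ := hy
  exact le_sInf fun H hH => key _ H (hB hH) (sInf_le hH) rfl

/-- A transversal chosen among the hyperplanes through the larger subspace cuts out both flats. -/
theorem eq_of_le (hA : IsCentralArrangement A) (hρ : HasModularLevels A ρ)
    {y z : Submodule K V} (hy : ∃ B ⊆ A, y = sInf B) (hz : ∃ B ⊆ A, z = sInf B) (hyz : y ≤ z)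
    (h : ∀ H ∈ A, y ≤ H → ∃ H' ∈ A, z ≤ H' ∧ ρ H' = ρ H) : y = z := by
  classical
  let E : Finset ℕ := (hA.1.toFinset.filter (y ≤ ·)).image ρ
  have hE : ∀ k, k ∈ E ↔ ∃ H ∈ A, y ≤ H ∧ ρ H = k := by
    simp [E, and_assoc]
  have : ∀ k, ∃ H, k ∈ E → H ∈ A ∧ ρ H = k ∧ z ≤ H := by
    intro k
    by_cases hk : k ∈ E
    · obtain ⟨H, hH, hyH, rfl⟩ := (hE k).1 hk
      obtain ⟨H', hH', hz', he⟩ := h H hH hyH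
      exact ⟨H', fun _ => ⟨hH', he, hz'⟩⟩
    · exact ⟨⊤, fun h => absurd h hk⟩
  choose f hf using this
  have e1 := eq_inf (h := f) (E := E) hA hρ hy (fun H hH hyH => (hE _).2 ⟨H, hH, hyH, rfl⟩)
    fun k hk => ⟨(hf k hk).1, (hf k hk).2.1, hyz.trans (hf k hk).2.2⟩
  have e2 := eq_inf (h := f) (E := E) hA hρ hz
    (fun H hH hyH => (hE _).2 ⟨H, hH, hyz.trans hyH, rfl⟩) hf
  rw [e1, ← e2]

/-- The flat cut out by the hyperplanes of level less than `i`. -/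
def flat (A : Set (Submodule K V)) (ρ : Submodule K V → ℕ) (i : ℕ) : IntersectionLattice A :=
  ⟨sInf {H | H ∈ A ∧ ρ H < i}, _, fun _ h => h.1, rfl⟩

theorem flat_le_iff (hρ : HasModularLevels A ρ) {H : Submodule K V} (hH : H ∈ A) {i : ℕ} :
    (flat A ρ i).1 ≤ H ↔ ρ H < i := by
  refine ⟨fun h => ?_, fun h => sInf_le ⟨hH, h⟩⟩
  by_contra hi
  refine hρ.not_sInf_le H hH (le_trans (sInf_le_sInf ?_) h)
  exact fun G hG => ⟨hG.1, hG.2.trans_le (not_lt.1 hi)⟩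

theorem finite_intersectionLattice (hA : A.Finite) : Finite (IntersectionLattice A) := by
  have : {X : Submodule K V | ∃ B ⊆ A, X = sInf B}.Finite := by
    refine (hA.powerset.image sInf).subset ?_
    rintro _ ⟨B, hB, rfl⟩
    exact ⟨B, hB, rfl⟩
  exact this.to_subtype

/-- A flat comparable with all of these lies between two consecutive ones. Their level sets differ
at most by the one level $j$, so the flat equals one of the two according to whether it has a
hyperplane of level $j$, by `eq_of_le`. -/
theorem isMaxChain_flat (hA : IsCentralArrangement A) (hρ : HasModularLevels A ρ) :
    IsMaxChain (· ≤ ·) (Set.range (flat A ρ)) := by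
  have hmono : ∀ {i j : ℕ}, i ≤ j → (flat A ρ j).1 ≤ (flat A ρ i).1 := by
    intro i j hij
    exact sInf_le_sInf fun G (hG : G ∈ A ∧ ρ G < i) => ⟨hG.1, hG.2.trans_le hij⟩
  refine ⟨?_, fun t ht hsub => hsub.antisymm fun y hy => ?_⟩
  · rintro _ ⟨i, rfl⟩ _ ⟨j, rfl⟩ -
    rcases le_total i j with h | h
    · exact Or.inl (hmono h)
    · exact Or.inr (hmono h)
  · have hcomp : ∀ i, y.1 ≤ (flat A ρ i).1 ∨ (flat A ρ i).1 ≤ y.1 := fun i =>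
      (ht.total hy (hsub ⟨i, rfl⟩)).symm
    by_cases hall : ∀ i, y.1 ≤ (flat A ρ i).1
    · refine ⟨hA.1.toFinset.sup ρ + 1, (Subtype.ext (eq_of_le hA hρ y.2 (flat A ρ _).2 (hall _) ?_)).symm⟩
      intro H hH _
      refine ⟨H, hH, (flat_le_iff hρ hH).2 (Nat.lt_succ_of_le ?_), rfl⟩
      exact Finset.le_sup (f := ρ) (hA.1.mem_toFinset.2 hH)
    · classical
      push Not at hall
      obtain ⟨j, hj, hj'⟩ : ∃ j, y.1 ≤ (flat A ρ j).1 ∧ ¬ y.1 ≤ (flat A ρ (j + 1)).1 := by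
        by_contra hcon
        push Not at hcon
        obtain ⟨i, hi⟩ := hall
        apply hi
        clear hi
        induction i with
        | zero => simp [flat]
        | succ i ih => exact hcon i ih
      have hle := (hcomp (j + 1)).resolve_left hj'
      by_cases hjT : ∃ H ∈ A, y.1 ≤ H ∧ ρ H = j
      · refine ⟨j + 1, Subtype.ext (eq_of_le hA hρ (flat A ρ _).2 y.2 hle fun H hH hlH => ?_)⟩
        have := (flat_le_iff hρ hH).1 hlH
        rcases Nat.lt_succ_iff_lt_or_eq.1 this with h | h
        · exact ⟨H, hH, hj.trans ((flat_le_iff hρ hH).2 h), rfl⟩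
        · obtain ⟨G, hG, hyG, hGj⟩ := hjT
          exact ⟨G, hG, hyG, hGj.trans h.symm⟩
      · refine ⟨j, (Subtype.ext (eq_of_le hA hρ y.2 (flat A ρ _).2 hj fun H hH hyH => ?_)).symm⟩
        have := (flat_le_iff hρ hH).1 (hle.trans hyH)
        rcases Nat.lt_succ_iff_lt_or_eq.1 this with h | h
        · exact ⟨H, hH, (flat_le_iff hρ hH).2 h, rfl⟩
        · exact absurd ⟨H, hH, hyH, h⟩ hjT

/-- In reverse inclusion, a minimal member of the chain with level $k$ is the largest such subspace;
any hyperplane of level $k$ through it contains all the other ones. -/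
theorem exists_base (hA : IsCentralArrangement A) {C : Set (IntersectionLattice A)}
    (hC : IsChain (· ≤ ·) C) {k : ℕ} (hk : k ∈ ρ '' A) :
    ∃ G ∈ A, ρ G = k ∧ ∀ c ∈ C, (∃ H ∈ A, c.1 ≤ H ∧ ρ H = k) → c.1 ≤ G := by
  have := finite_intersectionLattice hA.1
  obtain ⟨G, hG, hGk⟩ := hk
  rcases Set.eq_empty_or_nonempty {c | c ∈ C ∧ ∃ H ∈ A, c.1 ≤ H ∧ ρ H = k} with he | hne
  · refine ⟨G, hG, hGk, fun c hc hc' => ?_⟩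
    have : c ∈ (∅ : Set (IntersectionLattice A)) := he ▸ ⟨hc, hc'⟩
    exact this.elim
  · obtain ⟨c₀, hc₀⟩ := (Set.toFinite _).exists_minimal hne
    obtain ⟨H, hH, hle, hHk⟩ := hc₀.1.2
    refine ⟨H, hH, hHk, fun c hc hc' => ?_⟩
    rcases hC.total hc hc₀.1.1 with h | h
    · have : c₀ ≤ c := hc₀.2 ⟨hc, hc'⟩ h
      exact le_trans this hle
    · exact le_trans h hle

theorem isSupersolvable (hA : IsCentralArrangement A) (hρ : HasModularLevels A ρ) :
    IsSupersolvable A := by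
  classical
  refine ⟨_, isMaxChain_flat hA hρ, fun C hC => ?_⟩
  have : ∀ k, ∃ G, k ∈ ρ '' A → G ∈ A ∧ ρ G = k ∧
      ∀ c ∈ C, (∃ H ∈ A, c.1 ≤ H ∧ ρ H = k) → c.1 ≤ G := by
    intro k
    by_cases hk : k ∈ ρ '' A
    · obtain ⟨G, h⟩ := exists_base hA hC hk
      exact ⟨G, fun _ => h⟩
    · exact ⟨⊤, fun h => absurd h hk⟩
  choose h hh using this
  -- With one transversal $h$ adapted to the whole chain, a flat cut out by members of $h$ is
  -- encoded by its set of levels. Join becomes union and meet becomes intersection, so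
  -- distributivity is inherited from finite sets.
  let R : IntersectionLattice A → Finset ℕ → Prop := fun y E => ↑E ⊆ ρ '' A ∧ y.1 = E.inf h
  have hsup : ∀ {y z E F}, R y E → R z F → R (y ⊔ z) (E ∪ F) := by
    rintro y z E F ⟨h1, h2⟩ ⟨h3, h4⟩
    refine ⟨by rw [Finset.coe_union]; exact Set.union_subset h1 h3, ?_⟩
    rw [Finset.inf_union, ← h2, ← h4]
    rfl
  have hmem : ∀ {y E H}, R y E → H ∈ A → y.1 ≤ H → ρ H ∈ E := by
    rintro y E H ⟨h1, h2⟩ hH hle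
    exact level_mem_of_inf_le hA hρ (fun k hk => ⟨(hh k (h1 hk)).1, (hh k (h1 hk)).2.1⟩) hH
      (h2 ▸ hle)
  have hinf : ∀ {y z E F}, R y E → R z F → R (y ⊓ z) (E ∩ F) := by
    intro y z E F hy hz
    refine ⟨fun k hk => hy.1 (Finset.mem_inter.1 hk).1, eq_inf hA hρ (y ⊓ z).2 ?_ ?_⟩
    · intro H hH hle
      have hy' : y.1 ≤ (y ⊓ z).1 := (inf_le_left : y ⊓ z ≤ y)
      have hz' : z.1 ≤ (y ⊓ z).1 := (inf_le_right : y ⊓ z ≤ z)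
      exact Finset.mem_inter.2 ⟨hmem hy hH (hy'.trans hle), hmem hz hH (hz'.trans hle)⟩
    · intro k hk
      obtain ⟨hk1, hk2⟩ := Finset.mem_inter.1 hk
      obtain ⟨hG, hGk, -⟩ := hh k (hy.1 hk1)
      exact ⟨hG, hGk, sInf_le ⟨hG, hy.2 ▸ Finset.inf_le hk1, hz.2 ▸ Finset.inf_le hk2⟩⟩
  have hinj : ∀ {y z E}, R y E → R z E → y = z := fun h1 h2 => Subtype.ext (h1.2.trans h2.2.symm)
  have hsub : latticeClosure (Set.range (flat A ρ) ∪ C) ⊆ {y | ∃ E, R y E} := by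
    refine latticeClosure_min ?_ ⟨?_, ?_⟩
    · have hR : ∀ y : IntersectionLattice A, (∀ k, (∃ H ∈ A, y.1 ≤ H ∧ ρ H = k) → y.1 ≤ h k) →
          ∃ E, R y E := by
        intro y hy
        refine ⟨(hA.1.toFinset.filter (y.1 ≤ ·)).image ρ, ?_, eq_inf hA hρ y.2 ?_ ?_⟩
        · rintro k hk
          simp only [Finset.coe_image, Set.mem_image, Finset.coe_filter, Set.Finite.mem_toFinset,
            Set.mem_ofPred_eq] at hk
          obtain ⟨H, hH, rfl⟩ := hk
          exact ⟨H, hH.1, rfl⟩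
        · intro H hH hle
          exact Finset.mem_image_of_mem _ (Finset.mem_filter.2 ⟨hA.1.mem_toFinset.2 hH, hle⟩)
        · intro k hk
          obtain ⟨H, hH, rfl⟩ := Finset.mem_image.1 hk
          obtain ⟨hH, hle⟩ := Finset.mem_filter.1 hH
          have hH := hA.1.mem_toFinset.1 hH
          exact ⟨(hh _ ⟨H, hH, rfl⟩).1, (hh _ ⟨H, hH, rfl⟩).2.1, hy _ ⟨H, hH, hle, rfl⟩⟩
      rintro y (⟨i, rfl⟩ | hy) <;> apply hR <;> rintro k ⟨H, hH, hle, rfl⟩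
      · obtain ⟨hG, hGk, -⟩ := hh _ ⟨H, hH, rfl⟩
        rw [flat_le_iff hρ hG, hGk]
        exact (flat_le_iff hρ hH).1 hle
      · exact (hh _ ⟨H, hH, rfl⟩).2.2 _ hy ⟨H, hH, hle, rfl⟩
    · rintro y ⟨E, hE⟩ z ⟨F, hF⟩
      exact ⟨_, hsup hE hF⟩
    · rintro y ⟨E, hE⟩ z ⟨F, hF⟩
      exact ⟨_, hinf hE hF⟩
  intro x hx y hy z hz
  obtain ⟨E, hE⟩ := hsub hx
  obtain ⟨F, hF⟩ := hsub hy
  obtain ⟨G, hG⟩ := hsub hz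
  refine hinj (hinf hE (hsup hF hG)) ?_
  rw [Finset.inter_union_distrib_left]
  exact hsup (hinf hE hF) (hinf hE hG)

end HasModularLevels

/-- The level of a hyperplane with respect to a maximal chain of flats. -/
noncomputable def chainLevel (Δ : Set (IntersectionLattice A)) (X : Submodule K V) : ℕ :=
  {x | x ∈ Δ ∧ ¬ x.1 ≤ X}.ncard

/-- In lattice terms, let $x$ be the last chain member not above the atom $H$. An atom $H'$ of the
same level lies below $H\vee x$, and distributivity gives $H\vee H'=H\vee((H\vee H')\wedge x)$. The
meet on the right is therefore not the bottom, and an atom below it has lower level because it lies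
below $x$. -/
theorem IsMChain.hasModularLevels (hA : IsCentralArrangement A)
    {Δ : Set (IntersectionLattice A)} (hΔ : IsMChain Δ) :
    HasModularLevels A (chainLevel Δ) := by
  have := HasModularLevels.finite_intersectionLattice hA.1
  obtain ⟨⟨hchain, hmax⟩, hdist⟩ := hΔ
  have htotal : ∀ x ∈ Δ, ∀ y ∈ Δ, y.1 ≤ x.1 ∨ x.1 ≤ y.1 := fun x hx y hy => hchain.total hx hy
  have hins : ∀ y : IntersectionLattice A, (∀ x ∈ Δ, x ≤ y ∨ y ≤ x) → y ∈ Δ := by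
    intro y hy
    have : IsChain (· ≤ ·) (insert y Δ) := hchain.insert fun x hx _ => (hy x hx).symm
    rw [hmax this (Set.subset_insert y Δ)]
    exact Set.mem_insert y Δ
  have hbot : (⟨⊤, ∅, Set.empty_subset _, sInf_empty.symm⟩ : IntersectionLattice A) ∈ Δ :=
    hins _ fun x _ => Or.inr (le_top : x.1 ≤ ⊤)
  -- the largest member of the chain that does not contain the atom `H`
  have hex : ∀ H ∈ A, ∃ x ∈ Δ, ¬ x.1 ≤ H ∧ ∀ y ∈ Δ, ¬ y.1 ≤ H → x.1 ≤ y.1 := by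
    intro H hH
    obtain ⟨x, hx⟩ := (Set.toFinite {x | x ∈ Δ ∧ ¬ x.1 ≤ H}).exists_maximal
      ⟨_, hbot, fun h => (hA.2 H hH).1 (top_le_iff.1 h)⟩
    refine ⟨x, hx.1.1, hx.1.2, fun y hy hyH => ?_⟩
    rcases htotal x hx.1.1 y hy with h | h
    · exact hx.2 ⟨hy, hyH⟩ h
    · exact h
  have hcard : ∀ H H' : Submodule K V, ∀ x ∈ Δ, ¬ x.1 ≤ H' →
      (∀ y ∈ Δ, ¬ y.1 ≤ H → x.1 ≤ y.1) → chainLevel Δ H ≤ chainLevel Δ H' := by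
    intro H H' x hx hxH' hall
    exact Set.ncard_le_ncard (fun y hy => ⟨hy.1, fun h => hxH' ((hall y hy.1 hy.2).trans h)⟩)
      (Set.toFinite _)
  have hlt : ∀ H H' : Submodule K V, ∀ x ∈ Δ, ¬ x.1 ≤ H → x.1 ≤ H' →
      chainLevel Δ H' < chainLevel Δ H := by
    intro H H' x hx hxH hxH'
    refine Set.ncard_lt_ncard ⟨fun y hy => ⟨hy.1, fun h => ?_⟩, fun hsub => ?_⟩ (Set.toFinite _)
    · rcases htotal x hx y hy.1 with h' | h'
      · exact hy.2 (h'.trans hxH')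
      · exact hxH (h'.trans h)
    · exact (hsub ⟨hx, hxH⟩ : x ∈ Δ ∧ ¬ x.1 ≤ H').2 hxH'
  constructor
  · intro H hH H' hH' hne hlev
    obtain ⟨x, hx, hxH, hxmax⟩ := hex H hH
    let a : ∀ G ∈ A, IntersectionLattice A := fun G hG =>
      ⟨G, {G}, Set.singleton_subset_iff.2 hG, sInf_singleton.symm⟩
    -- Chain members not above $H$ are below $x$, the others are above $H\vee x$; maximality of the
    -- chain puts $H\vee x$ in it.
    have hsup : a H hH ⊔ x ∈ Δ := by
      refine hins _ fun y hy => ?_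
      by_cases hyH : y.1 ≤ H
      · refine Or.inr (sup_le hyH ?_)
        exact (htotal x hx y hy).resolve_right fun h => hxH (h.trans hyH)
      · have h' : y ≤ x := hxmax y hy hyH
        exact Or.inl (le_trans h' le_sup_right)
    have hsupH' : a H' hH' ≤ a H hH ⊔ x := by
      by_contra hcon
      have h1 : (a H hH ⊔ x).1 ≤ H := (le_sup_left : a H hH ≤ a H hH ⊔ x)
      exact (hlt H' H _ hsup hcon h1).ne hlev
    have hC : IsChain (· ≤ ·) {a H hH, a H hH ⊔ a H' hH'} :=
      IsChain.pair le_sup_left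
    have h := hdist _ hC (a H hH ⊔ a H' hH') (subset_latticeClosure (Or.inr (Or.inr rfl)))
      (a H hH) (subset_latticeClosure (Or.inr (Or.inl rfl)))
      x (subset_latticeClosure (Or.inl hx))
    rw [inf_eq_left.2 (sup_le le_sup_left hsupH'), inf_eq_right.2 le_sup_left] at h
    rcases Set.eq_empty_or_nonempty {G | G ∈ A ∧ (a H hH ⊔ a H' hH').1 ≤ G ∧ x.1 ≤ G} with he | ⟨G, hG⟩
    · exfalso
      have h2 : H ⊓ H' = H ⊓ sInf {G | G ∈ A ∧ (a H hH ⊔ a H' hH').1 ≤ G ∧ x.1 ≤ G} :=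
        congrArg Subtype.val h
      rw [he, sInf_empty, inf_top_eq, inf_eq_left] at h2
      exact hne ((hA.2 H hH).le_iff.1 h2 |>.resolve_left (hA.2 H' hH').1).symm
    · exact ⟨G, hG.1, hlt H G x hx hxH hG.2.2, hG.2.1⟩
  · intro H hH hle
    obtain ⟨x, hx, hxH, hxmax⟩ := hex H hH
    refine hxH (le_trans (le_sInf ?_) hle)
    rintro H' ⟨-, hlt'⟩
    by_contra hcon
    exact absurd (hcard H H' x hx hcon hxmax) (not_le.2 hlt')

end ModularLevels

/-! ### Modular levels for nests. -/

section NestLevels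

universe u

variable {K : Type u} [Field K] {ℓ : ℕ}

/-- The hyperplane `x_1 - x_j = a z`. -/
def hypOne (j : Set.Icc 2 ℓ) (a : K) : Submodule K ((Set.Icc 1 ℓ → K) × K) :=
  LinearMap.ker ((xOne j - xTail j) ∘ₗ LinearMap.fst K _ K - a • LinearMap.snd K _ K)

/-- The hyperplane `x_i = x_j`. -/
def hypDiff (i j : Set.Icc 2 ℓ) : Submodule K ((Set.Icc 1 ℓ → K) × K) :=
  LinearMap.ker ((xTail i - xTail j) ∘ₗ LinearMap.fst K (Set.Icc 1 ℓ → K) K)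

/-- The hyperplane `z = 0`. -/
def hypInfty (K : Type u) [Field K] (ℓ : ℕ) : Submodule K ((Set.Icc 1 ℓ → K) × K) :=
  LinearMap.ker (LinearMap.snd K (Set.Icc 1 ℓ → K) K)

/-- The unit vector of the coordinate `x_j`. -/
def tailVec (K : Type u) [Field K] (j : Set.Icc 2 ℓ) : (Set.Icc 1 ℓ → K) × K :=
  (Pi.single ⟨j.1, Set.mem_Icc.2 ⟨le_trans one_le_two j.2.1, j.2.2⟩⟩ 1, 0)

theorem mem_hypOne {j : Set.Icc 2 ℓ} {a : K} {v : (Set.Icc 1 ℓ → K) × K} :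
    v ∈ hypOne j a ↔ xOne j v.1 - xTail j v.1 = a * v.2 := by
  simp [hypOne, sub_eq_zero]

theorem mem_hypDiff {i j : Set.Icc 2 ℓ} {v : (Set.Icc 1 ℓ → K) × K} :
    v ∈ hypDiff i j ↔ xTail i v.1 = xTail j v.1 := by
  simp [hypDiff, sub_eq_zero]

theorem mem_hypInfty {v : (Set.Icc 1 ℓ → K) × K} : v ∈ hypInfty K ℓ ↔ v.2 = 0 := by
  simp [hypInfty]

theorem hypDiff_comm (i j : Set.Icc 2 ℓ) : (hypDiff i j : Submodule K _) = hypDiff j i := by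
  ext v
  rw [mem_hypDiff, mem_hypDiff, eq_comm]

theorem xTail_tailVec (i j : Set.Icc 2 ℓ) :
    xTail i (tailVec K j).1 = if i = j then 1 else 0 := by
  simp [xTail, coord, tailVec, Pi.single_apply, Subtype.ext_iff]

theorem xOne_tailVec (i j : Set.Icc 2 ℓ) : xOne i (tailVec K j).1 = 0 := by
  have : (1 : ℕ) ≠ j := by have := j.2.1; omega
  simp [xOne, coord, tailVec, this]

theorem tailVec_mem_hypOne {i j : Set.Icc 2 ℓ} {a : K} : tailVec K j ∈ hypOne i a ↔ i ≠ j := by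
  rw [mem_hypOne, xOne_tailVec, xTail_tailVec]
  split_ifs with h <;> simp [h, tailVec]

theorem tailVec_mem_hypDiff {i k j : Set.Icc 2 ℓ} (hik : i ≠ k) :
    tailVec K j ∈ hypDiff i k ↔ i ≠ j ∧ k ≠ j := by
  rw [mem_hypDiff, xTail_tailVec, xTail_tailVec]
  split_ifs with h h' h'
  · exact absurd (h.trans h'.symm) hik
  · simp [h]
  · simp [h']
  · simp [h, h']

theorem tailVec_mem_hypInfty {j : Set.Icc 2 ℓ} : tailVec K j ∈ hypInfty K ℓ := by
  rw [mem_hypInfty]; rfl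

theorem mem_coneNIsh_iff_of_injective (N : Set.Icc 2 ℓ → Finset K) {pos : Set.Icc 2 ℓ → ℕ}
    (hpos : Function.Injective pos) (H : Submodule K ((Set.Icc 1 ℓ → K) × K)) :
    H ∈ coneNIsh N ↔ H = hypInfty K ℓ ∨ (∃ j, ∃ a ∈ N j, H = hypOne j a) ∨
      ∃ j m, pos m < pos j ∧ H = hypDiff j m := by
  rw [mem_coneNIsh_iff]
  refine or_congr Iff.rfl (or_congr Iff.rfl ⟨?_, ?_⟩)
  · rintro ⟨i, j, hij, rfl⟩
    rcases lt_or_gt_of_ne (hpos.ne hij.ne) with h | h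
    · exact ⟨j, i, h, hypDiff_comm i j⟩
    · exact ⟨i, j, h, rfl⟩
  · rintro ⟨j, m, h, rfl⟩
    have hne : j ≠ m := fun he => by rw [he] at h; exact lt_irrefl _ h
    rcases lt_or_gt_of_ne hne with h | h
    · exact ⟨j, m, h, rfl⟩
    · exact ⟨m, j, h, hypDiff_comm j m⟩

open scoped Classical in
/-- The largest position of a coordinate `x_j` on which the hyperplane `H` depends. -/
noncomputable def tailLevel (pos : Set.Icc 2 ℓ → ℕ) (H : Submodule K ((Set.Icc 1 ℓ → K) × K)) :
    ℕ :=
  Finset.univ.sup fun j => if tailVec K j ∈ H then 0 else pos j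

theorem tailVec_mem_of_tailLevel_lt {pos : Set.Icc 2 ℓ → ℕ}
    {H : Submodule K ((Set.Icc 1 ℓ → K) × K)} {j : Set.Icc 2 ℓ} (h : tailLevel pos H < pos j) :
    tailVec K j ∈ H := by
  classical
  by_contra hn
  have := Finset.le_sup (f := fun j => if tailVec K j ∈ H then 0 else pos j) (Finset.mem_univ j)
  rw [if_neg hn] at this
  unfold tailLevel at h
  exact absurd h (not_lt.2 (by convert this))

theorem tailLevel_eq {pos : Set.Icc 2 ℓ → ℕ} {H : Submodule K ((Set.Icc 1 ℓ → K) × K)}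
    {j : Set.Icc 2 ℓ} (hj : tailVec K j ∉ H) (h : ∀ i, tailVec K i ∉ H → pos i ≤ pos j) :
    tailLevel pos H = pos j := by
  classical
  refine le_antisymm (Finset.sup_le fun i _ => ?_) ?_
  · split_ifs with hi
    · exact Nat.zero_le _
    · exact h i hi
  · by_contra hlt
    exact hj (tailVec_mem_of_tailLevel_lt (not_le.1 hlt))

theorem tailLevel_hypInfty (pos : Set.Icc 2 ℓ → ℕ) : tailLevel pos (hypInfty K ℓ) = 0 := by
  simp [tailLevel, tailVec_mem_hypInfty]

theorem tailLevel_hypOne (pos : Set.Icc 2 ℓ → ℕ) (j : Set.Icc 2 ℓ) (a : K) :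
    tailLevel pos (hypOne j a) = pos j := by
  refine tailLevel_eq (by simp [tailVec_mem_hypOne]) fun i hi => ?_
  rw [tailVec_mem_hypOne, not_not] at hi
  rw [hi]

theorem tailLevel_hypDiff {pos : Set.Icc 2 ℓ → ℕ} {j m : Set.Icc 2 ℓ} (h : pos m < pos j) :
    tailLevel pos (hypDiff j m : Submodule K _) = pos j := by
  have hne : j ≠ m := fun he => by rw [he] at h; exact lt_irrefl _ h
  refine tailLevel_eq (by simp [tailVec_mem_hypDiff hne]) fun i hi => ?_
  rw [tailVec_mem_hypDiff hne, not_and_or, not_not, not_not] at hi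
  rcases hi with rfl | rfl
  · exact le_rfl
  · exact h.le

/-- Among hyperplanes whose last coordinate is $x_j$, two of the first kind meet in $z=0$, a mixed
pair meets in $x_1-x_m=az$ by the nest condition, and two of the second kind meet in $x_m=x_{m'}$.
The unit vector of $x_j$ lies in every hyperplane of lower level but in none of this level.
Positions are positive so that level $0$ is left to $z=0$. -/
theorem hasModularLevels_coneNIsh {N : Set.Icc 2 ℓ → Finset K} {pos : Set.Icc 2 ℓ → ℕ}
    (hpos : Function.Injective pos) (h0 : ∀ j, 0 < pos j)
    (hN : ∀ i j, pos i < pos j → N j ⊆ N i) : HasModularLevels (coneNIsh N) (tailLevel pos) := by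
  have hz : hypInfty K ℓ ∈ coneNIsh N := (mem_coneNIsh_iff_of_injective N hpos _).2 (Or.inl rfl)
  have hD : ∀ j m : Set.Icc 2 ℓ, j ≠ m → hypDiff j m ∈ coneNIsh N := by
    intro j m hne
    rw [mem_coneNIsh_iff_of_injective N hpos]
    rcases lt_or_gt_of_ne (hpos.ne hne) with h | h
    · exact Or.inr (Or.inr ⟨m, j, h, hypDiff_comm j m⟩)
    · exact Or.inr (Or.inr ⟨j, m, h, rfl⟩)
  have hmixed : ∀ j m a, pos m < pos j → a ∈ N j → ∃ H'' ∈ coneNIsh N,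
      tailLevel pos H'' < pos j ∧ hypOne j a ⊓ hypDiff j m ≤ H'' := by
    intro j m a hm ha
    refine ⟨hypOne m a, (mem_coneNIsh_iff_of_injective N hpos _).2
      (Or.inr (Or.inl ⟨m, a, hN m j hm ha, rfl⟩)), by rwa [tailLevel_hypOne], ?_⟩
    rintro v ⟨h1, h2⟩
    rw [SetLike.mem_coe, mem_hypOne] at h1
    rw [SetLike.mem_coe, mem_hypDiff] at h2
    rw [mem_hypOne, ← h2, ← h1]
    rfl
  constructor
  · intro H hH H' hH' hne hlev
    rcases (mem_coneNIsh_iff_of_injective N hpos H).1 hH with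
      rfl | ⟨j, a, ha, rfl⟩ | ⟨j, m, hm, rfl⟩ <;>
    rcases (mem_coneNIsh_iff_of_injective N hpos H').1 hH' with
      rfl | ⟨j', b, hb, rfl⟩ | ⟨j', m', hm', rfl⟩
    · exact absurd rfl hne
    · rw [tailLevel_hypInfty, tailLevel_hypOne] at hlev
      exact absurd hlev (h0 j').ne
    · rw [tailLevel_hypInfty, tailLevel_hypDiff hm'] at hlev
      exact absurd hlev (h0 j').ne
    · rw [tailLevel_hypInfty, tailLevel_hypOne] at hlev
      exact absurd hlev (h0 j).ne'
    · rw [tailLevel_hypOne, tailLevel_hypOne] at hlev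
      obtain rfl := hpos hlev
      refine ⟨_, hz, by rw [tailLevel_hypInfty, tailLevel_hypOne]; exact h0 j, ?_⟩
      rintro v ⟨h1, h2⟩
      rw [SetLike.mem_coe, mem_hypOne] at h1 h2
      rw [mem_hypInfty]
      by_contra hv
      rw [h1] at h2
      exact hne (by rw [mul_right_cancel₀ hv h2])
    · rw [tailLevel_hypOne, tailLevel_hypDiff hm'] at hlev
      obtain rfl := hpos hlev
      rw [tailLevel_hypOne]
      exact hmixed j m' a hm' ha
    · rw [tailLevel_hypInfty, tailLevel_hypDiff hm] at hlev
      exact absurd hlev (h0 j).ne'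
    · rw [tailLevel_hypOne, tailLevel_hypDiff hm] at hlev
      obtain rfl := hpos hlev
      rw [tailLevel_hypDiff hm, inf_comm]
      exact hmixed j m b hm hb
    · rw [tailLevel_hypDiff hm, tailLevel_hypDiff hm'] at hlev
      obtain rfl := hpos hlev
      have hmm : m ≠ m' := fun h => hne (by rw [h])
      refine ⟨hypDiff m m', hD m m' hmm, ?_, ?_⟩
      · rw [tailLevel_hypDiff hm]
        rcases lt_or_gt_of_ne (hpos.ne hmm) with h | h
        · rwa [hypDiff_comm, tailLevel_hypDiff h]
        · rwa [tailLevel_hypDiff h]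
      · rintro v ⟨h1, h2⟩
        rw [SetLike.mem_coe, mem_hypDiff] at h1 h2
        rw [mem_hypDiff, ← h1, ← h2]
  · intro H hH hle
    have key : ∀ j, tailLevel pos H = pos j → tailVec K j ∈ H := by
      intro j hj
      refine hle (Submodule.mem_sInf.2 ?_)
      rintro G ⟨-, hG⟩
      exact tailVec_mem_of_tailLevel_lt (hj ▸ hG)
    rcases (mem_coneNIsh_iff_of_injective N hpos H).1 hH with
      rfl | ⟨j, a, ha, rfl⟩ | ⟨j, m, hm, rfl⟩
    · rw [tailLevel_hypInfty] at hle
      have : ((0, 1) : (Set.Icc 1 ℓ → K) × K) ∈ hypInfty K ℓ :=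
        hle (Submodule.mem_sInf.2 fun G hG => absurd hG.2 (Nat.not_lt_zero _))
      rw [mem_hypInfty] at this
      exact one_ne_zero this
    · simpa [tailVec_mem_hypOne] using key j (tailLevel_hypOne pos j a)
    · have hne : j ≠ m := fun he => by rw [he] at hm; exact lt_irrefl _ hm
      simpa [tailVec_mem_hypDiff hne] using key j (tailLevel_hypDiff hm)

theorem IsNest.exists_hasModularLevels {N : Set.Icc 2 ℓ → Finset K} (h : IsNest N) :
    ∃ ρ, HasModularLevels (coneNIsh N) ρ := by
  obtain ⟨w, hw⟩ := h
  have hle : ∀ j, ((w.symm j : Set.Icc 2 ℓ) : ℕ) ≤ ℓ := fun j => (w.symm j).2.2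
  -- The nest order is reversed, so that larger sets come first; $\ell+1$ instead of $\ell$ keeps
  -- the positions positive.
  refine ⟨_, hasModularLevels_coneNIsh (pos := fun j => ℓ + 1 - (w.symm j : Set.Icc 2 ℓ)) ?_ ?_ ?_⟩
  · intro i j hij
    have h1 := hle i
    have h2 := hle j
    exact w.symm.injective (Subtype.ext (by dsimp only at hij; omega))
  · intro j
    have := hle j
    omega
  · intro i j hij
    have := hw (w.symm j) (w.symm i) (Subtype.coe_le_coe.1 (by omega))
    simpa using this

end NestLevels

/-! ### Defining polynomials, the rank of $D(\mathcal A)$, Saito's criterion. -/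

section Saito

universe u v

variable {K : Type u} [Field K] {V : Type v} [AddCommGroup V] [Module K V]

theorem prod_pow_dvd_of_prime {R ι : Type*} [CommRing R] [IsDomain R] {s : Finset ι} {p : ι → R}
    {k : ι → ℕ} {f : R} (hp : ∀ i ∈ s, Prime (p i))
    (hne : ∀ i ∈ s, ∀ j ∈ s, p i ∣ p j → i = j) (h : ∀ i ∈ s, p i ^ k i ∣ f) :
    ∏ i ∈ s, p i ^ k i ∣ f := by
  classical
  induction s using Finset.induction_on with
  | empty => simp
  | insert a s ha ih =>
    obtain ⟨c, rfl⟩ := ih (fun i hi => hp i (Finset.mem_insert_of_mem hi))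
      (fun i hi j hj => hne i (Finset.mem_insert_of_mem hi) j (Finset.mem_insert_of_mem hj))
      (fun i hi => h i (Finset.mem_insert_of_mem hi))
    have hpa := hp a (Finset.mem_insert_self a s)
    have hnd : ¬ p a ∣ ∏ i ∈ s, p i ^ k i := by
      intro hd
      obtain ⟨j, hj, hd⟩ := hpa.exists_mem_finset_dvd hd
      have := hne a (Finset.mem_insert_self a s) j (Finset.mem_insert_of_mem hj)
        (hpa.dvd_of_dvd_pow hd)
      exact ha (this ▸ hj)
    have := hpa.pow_dvd_of_dvd_mul_left _ hnd (h a (Finset.mem_insert_self a s))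
    rw [Finset.prod_insert ha, mul_comm]
    exact mul_dvd_mul_left _ this

theorem prod_dvd_of_prime {R ι : Type*} [CommRing R] [IsDomain R] {s : Finset ι} {p : ι → R}
    {f : R} (hp : ∀ i ∈ s, Prime (p i))
    (hne : ∀ i ∈ s, ∀ j ∈ s, p i ∣ p j → i = j) (h : ∀ i ∈ s, p i ∣ f) :
    ∏ i ∈ s, p i ∣ f := by
  simpa using prod_pow_dvd_of_prime (k := fun _ => 1) hp hne (by simpa using h)

/-! ### Defining forms -/

open scoped Classical in
/-- A linear form with kernel `H`. -/
noncomputable def defForm (H : Submodule K V) : Module.Dual K V :=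
  if h : ∃ α : Module.Dual K V, LinearMap.ker α = H then h.choose else 0

theorem ker_defForm {H : Submodule K V} (hH : IsCoatom H) : LinearMap.ker (defForm H) = H := by
  have h := exists_ker_eq_of_isCoatom hH
  rw [defForm, dif_pos h]
  exact h.choose_spec

theorem defForm_ne_zero {H : Submodule K V} (hH : IsCoatom H) : defForm H ≠ 0 :=
  ne_zero_of_isCoatom_ker (by rwa [ker_defForm hH])

theorem defForm_prime {H : Submodule K V} (hH : IsCoatom H) : Prime (linForm (defForm H)) :=
  linForm_prime (defForm_ne_zero hH)

theorem eq_of_defForm_dvd {H H' : Submodule K V} (hH : IsCoatom H) (hH' : IsCoatom H')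
    (h : linForm (defForm H) ∣ linForm (defForm H')) : H = H' := by
  have := ker_le_ker_of_linForm_dvd h
  rw [ker_defForm hH, ker_defForm hH'] at this
  exact (hH.le_iff.1 this |>.resolve_left hH'.1).symm

theorem prod_defForm_dvd {s : Finset (Submodule K V)} (hs : ∀ H ∈ s, IsCoatom H) {f : PolyFun K V}
    (h : ∀ H ∈ s, linForm (defForm H) ∣ f) : ∏ H ∈ s, linForm (defForm H) ∣ f :=
  prod_dvd_of_prime (fun H hH => defForm_prime (hs H hH))
    (fun H hH H' hH' => eq_of_defForm_dvd (hs H hH) (hs H' hH')) h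

theorem isHomog_prod_defForm (s : Finset (Submodule K V)) :
    IsHomog (∏ H ∈ s, linForm (defForm H)) s.card := by
  have := isHomog_prod s (d := fun _ => 1) fun H _ => isHomog_linForm (defForm H)
  simpa using this

theorem prod_defForm_ne_zero {s : Finset (Submodule K V)} (hs : ∀ H ∈ s, IsCoatom H) :
    ∏ H ∈ s, linForm (defForm H) ≠ 0 :=
  Finset.prod_ne_zero_iff.2 fun H hH => (defForm_prime (hs H hH)).ne_zero

variable {A : Set (Submodule K V)}

theorem der_linForm_smul (θ : Der K V) (c : K) (α : Module.Dual K V) :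
    θ (linForm (c • α)) = algebraMap K _ c * θ (linForm α) := by
  rw [linForm_smul, Derivation.leibniz, Derivation.map_algebraMap, smul_zero, add_zero,
    smul_eq_mul]

theorem linForm_dvd_der_of_ker_eq {θ : Der K V} {α β : Module.Dual K V}
    (h : LinearMap.ker α = LinearMap.ker β) (hα : linForm α ∣ θ (linForm α)) :
    linForm β ∣ θ (linForm β) := by
  obtain ⟨c, rfl⟩ := exists_smul_eq_of_ker_le h.le
  rw [der_linForm_smul]
  exact ((linForm_dvd_of_ker_le h.ge).trans hα).mul_left _

theorem mem_logDer_iff (hA : ∀ H ∈ A, IsCoatom H) {θ : Der K V} :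
    θ ∈ logDer A ↔ ∀ H ∈ A, linForm (defForm H) ∣ θ (linForm (defForm H)) := by
  constructor
  · intro h H hH
    exact h _ ((ker_defForm (hA H hH)).symm ▸ hH)
  · intro h α hα
    exact linForm_dvd_der_of_ker_eq (ker_defForm (hA _ hα)) (h _ hα)

/-! ### The module of derivations -/

variable {ι : Type*}

theorem der_linForm_eq_sum [Fintype ι] (x : Module.Basis ι K (Module.Dual K V)) (θ : Der K V)
    (α : Module.Dual K V) :
    θ (linForm α) = ∑ j, algebraMap K (PolyFun K V) (x.repr α j) * θ (linForm (x j)) := by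
  conv_lhs => rw [← x.sum_repr α, linForm, map_sum, map_sum]
  exact Finset.sum_congr rfl fun j _ => der_linForm_smul _ _ _

/-- The value of a derivation at a linear form. -/
def derEval (α : Module.Dual K V) : Der K V →ₗ[PolyFun K V] PolyFun K V where
  toFun θ := θ (linForm α)
  map_add' _ _ := rfl
  map_smul' _ _ := rfl

theorem derEval_apply (α : Module.Dual K V) (θ : Der K V) : derEval α θ = θ (linForm α) := rfl

/-- A derivation is determined by its values on a basis of linear forms. -/
noncomputable def derEquiv [Fintype ι] (x : Module.Basis ι K (Module.Dual K V)) :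
    Der K V ≃ₗ[PolyFun K V] (ι → PolyFun K V) :=
  LinearEquiv.ofBijective (LinearMap.pi fun j => derEval (x j))
    ⟨fun θ η h => der_ext fun α => by
        rw [der_linForm_eq_sum x θ, der_linForm_eq_sum x η]
        exact Finset.sum_congr rfl fun j _ => congrArg _ (congrFun h j),
      fun f => by
        obtain ⟨θ, hθ⟩ := exists_der (x.constr K f)
        exact ⟨θ, funext fun j => (hθ _).trans (x.constr_basis K f j)⟩⟩

/-- The basis of coordinate derivations. -/
noncomputable def derBasis [Fintype ι] (x : Module.Basis ι K (Module.Dual K V)) :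
    Module.Basis ι (PolyFun K V) (Der K V) :=
  Module.Basis.ofEquivFun (derEquiv x)

theorem derBasis_linForm [Fintype ι] [DecidableEq ι] (x : Module.Basis ι K (Module.Dual K V))
    (i j : ι) : derBasis x i (linForm (x j)) = if i = j then 1 else 0 := by
  change derEquiv x (derBasis x i) j = _
  rw [derBasis, Module.Basis.coe_ofEquivFun, LinearEquiv.apply_symm_apply, Pi.single_apply]
  simp [eq_comm]

theorem mul_derBasis_mem (hA : IsCentralArrangement A) [Fintype ι]
    (x : Module.Basis ι K (Module.Dual K V)) (j : ι) :
    (∏ H ∈ hA.1.toFinset, linForm (defForm H)) • derBasis x j ∈ logDer A := by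
  rw [mem_logDer_iff hA.2]
  intro H hH
  rw [Derivation.smul_apply, smul_eq_mul]
  exact (Finset.dvd_prod_of_mem _ (hA.1.mem_toFinset.2 hH)).mul_right _

/-- With $Q$ the defining polynomial, $Q\,\mathrm{Der}(S)\subseteq D(\mathcal
A)\subseteq\mathrm{Der}(S)$, so both modules have the same rank. -/
theorem nonempty_equiv_of_basis (hA : IsCentralArrangement A) [Fintype ι]
    (x : Module.Basis ι K (Module.Dual K V)) {κ : Type*}
    (b : Module.Basis κ (PolyFun K V) (logDer A)) : Nonempty (κ ≃ ι) := by
  classical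
  have hfin : Module.Finite (PolyFun K V) (Der K V) := Module.Finite.of_basis (derBasis x)
  have hli : LinearIndependent (PolyFun K V) fun k => (b k : Der K V) :=
    b.linearIndependent.map_injOn (logDer A).subtype
      (Set.injOn_of_injective (logDer A).injective_subtype)
  have : Finite κ := hli.finite
  have := Fintype.ofFinite κ
  have h1 := hli.fintype_card_le_finrank
  rw [Module.finrank_eq_card_basis (derBasis x)] at h1
  have hfin' : Module.Finite (PolyFun K V) (logDer A) := Module.Finite.of_basis b
  have hli' : LinearIndependent (PolyFun K V)
      fun j => (⟨_, mul_derBasis_mem hA x j⟩ : logDer A) := by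
    refine LinearIndependent.of_comp (logDer A).subtype ?_
    have hQ := prod_defForm_ne_zero (s := hA.1.toFinset) fun H hH => hA.2 H (hA.1.mem_toFinset.1 hH)
    rw [Fintype.linearIndependent_iff]
    intro g hg j
    have h := Fintype.linearIndependent_iff.1 (derBasis x).linearIndependent
      (fun j => g j * ∏ H ∈ hA.1.toFinset, linForm (defForm H)) (by simpa [mul_smul] using hg) j
    exact (mul_eq_zero.1 h).resolve_right hQ
  have h2 := hli'.fintype_card_le_finrank
  rw [Module.finrank_eq_card_basis b] at h2
  exact ⟨Fintype.equivOfCardEq (le_antisymm h1 h2)⟩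

/-! ### Saito's criterion -/

/-- The coefficient matrix of a family of derivations. -/
def coefMat {κ : Type*} (x : ι → Module.Dual K V) (θ : κ → Der K V) :
    Matrix κ ι (PolyFun K V) :=
  Matrix.of fun i j => θ i (linForm (x j))

theorem exists_basis_apply_eq {W : Type*} [AddCommGroup W] [Module K W]
    (x : Module.Basis ι K W) {w : W} (hw : w ≠ 0) :
    ∃ (y : Module.Basis ι K W) (j : ι), y j = w := by
  have hli : LinearIndepOn K id ({w} : Set W) := (linearIndepOn_singleton_iff K).2 hw
  let y := Module.Basis.extend hli
  have hw' : w ∈ hli.extend (Set.subset_univ _) := hli.subset_extend _ rfl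
  refine ⟨y.reindex (y.indexEquiv x), y.indexEquiv x ⟨w, hw'⟩, ?_⟩
  rw [Module.Basis.reindex_apply, Equiv.symm_apply_apply]
  exact Module.Basis.extend_apply_self hli _

variable [Fintype ι] [DecidableEq ι]

/-- Restricted to $H$, the coefficient matrix kills the nonzero coordinate vector of $\alpha_H$, so
its determinant is divisible by $\alpha_H$. -/
theorem prod_defForm_dvd_det (hA : IsCentralArrangement A)
    (x : Module.Basis ι K (Module.Dual K V)) {θ : ι → Der K V} (hθ : ∀ i, θ i ∈ logDer A) :
    ∏ H ∈ hA.1.toFinset, linForm (defForm H) ∣ (coefMat x θ).det := by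
  refine prod_defForm_dvd (fun H hH => hA.2 H (hA.1.mem_toFinset.1 hH)) fun H hH => ?_
  have hH := hA.1.mem_toFinset.1 hH
  rw [← res_eq_zero_iff, AlgHom.map_det, ← Matrix.exists_mulVec_eq_zero_iff]
  refine ⟨fun j => algebraMap K _ (x.repr (defForm H) j), fun h => ?_, ?_⟩
  · apply defForm_ne_zero (hA.2 H hH)
    apply x.repr.injective
    ext j
    have := congrFun h j
    simpa using this
  · ext i
    have h := res_eq_zero_iff.2 ((mem_logDer_iff hA.2).1 (hθ i) H hH)
    rw [der_linForm_eq_sum x, map_sum] at h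
    rw [Pi.zero_apply, ← h]
    simp [Matrix.mulVec, dotProduct, coefMat, mul_comm]

theorem det_dvd_det_of_basis (x : ι → Module.Dual K V)
    (b : Module.Basis ι (PolyFun K V) (logDer A)) {θ : ι → Der K V} (hθ : ∀ i, θ i ∈ logDer A) :
    (coefMat x fun i => (b i : Der K V)).det ∣ (coefMat x θ).det := by
  have : coefMat x θ = Matrix.of (fun i k => b.repr ⟨θ i, hθ i⟩ k) *
      coefMat x fun i => (b i : Der K V) := by
    ext i j
    have h := congrArg (derEval (x j) ∘ₗ (logDer A).subtype) (b.sum_repr ⟨θ i, hθ i⟩)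
    simp only [map_sum, map_smul, smul_eq_mul, LinearMap.comp_apply, Submodule.subtype_apply,
      derEval_apply] at h
    simp only [coefMat, Matrix.of_apply, Matrix.mul_apply]
    exact h.symm
  rw [this, Matrix.det_mul]
  exact Dvd.intro_left _ rfl

theorem det_coefMat_dvd (x : Module.Basis ι K (Module.Dual K V)) (y : ι → Module.Dual K V)
    (θ : ι → Der K V) : (coefMat x θ).det ∣ (coefMat y θ).det := by
  have : coefMat y θ = coefMat x θ * Matrix.of fun k j => algebraMap K _ (x.repr (y j) k) := by
    ext i j
    simp only [coefMat, Matrix.of_apply, Matrix.mul_apply]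
    rw [der_linForm_eq_sum x]
    exact Finset.sum_congr rfl fun k _ => mul_comm _ _
  rw [this, Matrix.det_mul]
  exact Dvd.intro _ rfl

/-- The determinant of a basis of `D(A)` is, up to a unit, the defining polynomial of `A`. -/
theorem exists_det_eq (hA : IsCentralArrangement A) (x : Module.Basis ι K (Module.Dual K V))
    (b : Module.Basis ι (PolyFun K V) (logDer A)) :
    ∃ k, IsUnit k ∧ (coefMat x fun i => (b i : Der K V)).det =
      (∏ H ∈ hA.1.toFinset, linForm (defForm H)) * k := by
  classical
  have hUFD := polyFun_uniqueFactorizationMonoid (K := K) (V := V)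
  set Q := ∏ H ∈ hA.1.toFinset, linForm (defForm H) with hQdef
  have hcoat : ∀ H ∈ hA.1.toFinset, IsCoatom H := fun H hH => hA.2 H (hA.1.mem_toFinset.1 hH)
  have hQ : Q ≠ 0 := prod_defForm_ne_zero hcoat
  obtain ⟨k, hk⟩ := prod_defForm_dvd_det hA x fun i => (b i).2
  refine ⟨k, ?_, hk⟩
  -- Comparison with the derivations $Q\,\partial_j\in D(\mathcal A)$: every prime factor of the
  -- cofactor $k$ divides $Q$, hence is associated to some $\alpha_H$.
  have hpow : (coefMat x fun i => (b i : Der K V)).det ∣ Q ^ Fintype.card ι := by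
    have := det_dvd_det_of_basis x b (fun i => mul_derBasis_mem hA x i)
    have h2 : coefMat x (fun i => (∏ H ∈ hA.1.toFinset, linForm (defForm H)) • derBasis x i) =
        Q • (1 : Matrix ι ι (PolyFun K V)) := by
      ext i j
      simp only [coefMat, Matrix.of_apply, Derivation.smul_apply, derBasis_linForm,
        Matrix.smul_apply, Matrix.one_apply, hQdef]
    rwa [h2, Matrix.det_smul, Matrix.det_one, mul_one] at this
  have hk0 : k ≠ 0 := by
    rintro rfl
    rw [hk, mul_zero, zero_dvd_iff] at hpow
    exact pow_ne_zero _ hQ hpow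
  by_contra hunit
  obtain ⟨p, hp, hpk⟩ := WfDvdMonoid.exists_irreducible_factor hunit hk0
  have hp' : Prime p := hp.prime
  have hpQ : p ∣ Q := hp'.dvd_of_dvd_pow ((hpk.trans (Dvd.intro_left _ hk.symm)).trans hpow)
  obtain ⟨H, hH, hpH⟩ := hp'.exists_mem_finset_dvd hpQ
  have hHc := hcoat H hH
  have hHp : linForm (defForm H) ∣ p :=
    (hp.dvd_symm (defForm_prime hHc).irreducible) hpH
  set R := ∏ H' ∈ hA.1.toFinset.erase H, linForm (defForm H') with hR
  have hQR : Q = linForm (defForm H) * R := (Finset.mul_prod_erase _ _ hH).symm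
  obtain ⟨y, j₀, hy⟩ := exists_basis_apply_eq x (defForm_ne_zero hHc)
  -- In coordinates with $y_{j_0}=\alpha_H$ only $\partial_{j_0}$ moves $\alpha_H$, so the other
  -- $\partial_j$ need just the factor $R=Q/\alpha_H$. The determinant $\alpha_H R^n$ contains
  -- $\alpha_H$ once, which shows that $k$ divides a power of $R$ and so is prime to $\alpha_H$.
  let η : ι → Der K V := fun j => (if j = j₀ then linForm (defForm H) * R else R) • derBasis y j
  have hη : ∀ j, η j ∈ logDer A := by
    intro j
    rw [mem_logDer_iff hA.2]
    intro H' hH'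
    simp only [η, Derivation.smul_apply, smul_eq_mul]
    by_cases hHH : H' = H
    · subst hHH
      rw [← hy, derBasis_linForm]
      split_ifs
      · exact (dvd_mul_right _ _).mul_right _
      · rw [mul_zero]; exact dvd_zero _
    · have : linForm (defForm H') ∣ R := Finset.dvd_prod_of_mem _
        (Finset.mem_erase.2 ⟨hHH, hA.1.mem_toFinset.2 hH'⟩)
      split_ifs
      · exact (this.mul_left _).mul_right _
      · exact this.mul_right _
  have hdet : (coefMat y η).det = linForm (defForm H) * R ^ Fintype.card ι := by
    have h2 : coefMat y η =
        Matrix.diagonal fun j => if j = j₀ then linForm (defForm H) * R else R := by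
      ext i j
      simp only [coefMat, Matrix.of_apply, η, Derivation.smul_apply, derBasis_linForm,
        smul_eq_mul, Matrix.diagonal_apply]
      split_ifs <;> simp
    rw [h2, Matrix.det_diagonal, ← Finset.mul_prod_erase _ _ (Finset.mem_univ j₀), if_pos rfl,
      Finset.prod_congr rfl (g := fun _ => R), Finset.prod_const, Finset.card_erase_of_mem
        (Finset.mem_univ _), Finset.card_univ, mul_assoc, ← pow_succ', Nat.sub_add_cancel
        (Fintype.card_pos_iff.2 ⟨j₀⟩)]
    intro j hj
    exact if_neg (Finset.ne_of_mem_erase hj)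
  have hdvd := (det_coefMat_dvd x y fun i => (b i : Der K V)).trans
    (det_dvd_det_of_basis y b hη)
  rw [hk, ← hQdef, hQR, hdet, ← Nat.sub_add_cancel (Fintype.card_pos_iff.2 ⟨j₀⟩), pow_succ',
    mul_assoc] at hdvd
  have hR0 : R ≠ 0 := fun h => hQ (by rw [hQR, h, mul_zero])
  have hkR := (mul_dvd_mul_iff_left hR0).1
    ((mul_dvd_mul_iff_left (defForm_prime hHc).ne_zero).1 hdvd)
  obtain ⟨H', hH', hpH'⟩ := hp'.exists_mem_finset_dvd (hp'.dvd_of_dvd_pow (hpk.trans hkR))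
  have := eq_of_defForm_dvd hHc (hcoat H' (Finset.mem_of_mem_erase hH')) (hHp.trans hpH')
  exact Finset.ne_of_mem_erase hH' this.symm

/-- `degreeHom` multiplies row $i$ by $X^{d_i}$, and the determinant is multilinear in the rows. -/
theorem isHomog_det {M : Matrix ι ι (PolyFun K V)} {d : ι → ℕ}
    (h : ∀ i j, IsHomog (M i j) (d i)) : IsHomog M.det (∑ i, d i) := by
  unfold IsHomog at *
  rw [AlgHom.map_det]
  have : degreeHom.mapMatrix M = Matrix.of fun i j =>
      (Polynomial.X ^ d i) * (Polynomial.C.mapMatrix M) i j := by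
    ext1 i j
    simp only [AlgHom.mapMatrix_apply, Matrix.map_apply, Matrix.of_apply, RingHom.mapMatrix_apply]
    rw [h, mul_comm]
  rw [this, Matrix.det_mul_column, ← RingHom.map_det, Finset.prod_pow_eq_pow_sum, mul_comm]

/-- The exponents of a free arrangement add up to the number of hyperplanes. -/
theorem sum_degrees_eq (hA : IsCentralArrangement A) (x : Module.Basis ι K (Module.Dual K V))
    (b : Module.Basis ι (PolyFun K V) (logDer A)) {d : ι → ℕ}
    (hd : ∀ i, IsHomogeneousDer (b i : Der K V) (d i)) :
    ∑ i, d i = hA.1.toFinset.card := by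
  obtain ⟨k, hk, hdet⟩ := exists_det_eq hA x b
  have h1 : IsHomog (coefMat x fun i => (b i : Der K V)).det (∑ i, d i) :=
    isHomog_det fun i j => isHomogeneousDer_iff.1 (hd i) _
  rw [hdet] at h1
  have hQ := prod_defForm_ne_zero (s := hA.1.toFinset) fun H hH => hA.2 H (hA.1.mem_toFinset.1 hH)
  obtain ⟨hle, hkh⟩ := (isHomog_prod_defForm hA.1.toFinset).of_mul_left hQ h1
  have hle := hle.resolve_left hk.ne_zero
  obtain ⟨l, hl⟩ := hk.exists_right_inv
  have h2 := hkh.of_mul_left hk.ne_zero (hl ▸ isHomog_one)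
  have hl0 : l ≠ 0 := by
    rintro rfl
    rw [mul_zero] at hl
    exact zero_ne_one hl
  have := h2.1.resolve_left hl0
  omega

end Saito

/-! ### Incomparable sets obstruct freeness. -/

section NotNest

universe u v

/-- Writing only columns $i,j$ after $z,P,Q$ are extracted,
$\det(h,k)=\alpha\det(h',k)+Q_0\det(m,k)$ and $\det(m,k)=\alpha\det(m,k')$. So a further $\alpha$
comes out, with cofactor $q=\det(h',k)+Q_0\det(m,k')$. Under `ev` the column $k$ and the scalar
$Q_0$ vanish, hence so does $q$. -/
theorem exists_det_eq_mul {R F ι : Type*} [CommRing R] [CommRing F] [Fintype ι] [DecidableEq ι]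
    (ev : R →+* F) {M : Matrix ι ι R} {c i j : ι} (hci : c ≠ i) (hcj : c ≠ j) (hij : i ≠ j)
    {ζ h k h' k' m : ι → R} {z P P₀ Q Q₀ u v α : R}
    (hz : ∀ r, M r c = z * ζ r) (hi : ∀ r, M r i = P * h r + u * ζ r)
    (hj : ∀ r, M r j = Q * k r + v * ζ r) (hh : ∀ r, h r = α * h' r + Q₀ * m r)
    (hk : ∀ r, k r = α * k' r + P₀ * m r) (hα : ev α = 0) (hP : ev P₀ = 0) (hQ : ev Q₀ = 0) :
    ∃ q, ev q = 0 ∧ M.det = z * P * Q * α * q := by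
  let f : (ι → R) [⋀^ι]→ₗ[R] R := Matrix.detRowAlternating
  have step : ∀ (w : ι → ι → R) (a b : ι) (s t : R) (x : ι → R), a ≠ b →
      w a = s • x + t • w b → f w = s * f (Function.update w a x) := by
    intro w a b s t x hab hw
    have h1 : f w = f (Function.update w a (s • x + t • w b)) := by
      rw [← hw, Function.update_eq_self]
    rw [h1, f.map_update_add, f.map_update_smul, f.map_update_smul, f.map_update_self w hab]
    simp
  have hM : M.det = f M.transpose := (Matrix.det_transpose M).symm
  let w₀ : ι → ι → R := fun a r => M r a
  let w₁ := Function.update w₀ c ζ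
  let w₂ := Function.update w₁ i h
  let w₃ := Function.update w₂ j k
  let w₄ := Function.update w₃ i m
  have e0 : f w₀ = z * f w₁ := by
    refine step w₀ c i z 0 ζ hci (funext fun r => ?_)
    simpa [w₀] using hz r
  have e1 : f w₁ = P * f w₂ := by
    refine step w₁ i c P u h hci.symm (funext fun r => ?_)
    simpa [w₁, w₀, hci.symm] using hi r
  have e2 : f w₂ = Q * f w₃ := by
    refine step w₂ j c Q v k hcj.symm (funext fun r => ?_)
    simpa [w₂, w₁, w₀, hcj.symm, hij.symm, hci] using hj r
  have e3 : f w₃ = α * f (Function.update w₃ i h') + Q₀ * f w₄ := by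
    have : f w₃ = f (Function.update w₃ i (α • h' + Q₀ • m)) := by
      congr 1
      rw [eq_comm, Function.update_eq_self_iff]
      ext r
      simpa [w₃, w₂, hij] using (hh r).symm
    rw [this, f.map_update_add, f.map_update_smul, f.map_update_smul, smul_eq_mul, smul_eq_mul]
  -- Column $i$ is now $m$, so the summand $P_0m$ of column $j$ contributes nothing.
  have e4 : f w₄ = α * f (Function.update w₄ j k') := by
    refine step w₄ j i α P₀ k' hij.symm (funext fun r => ?_)
    simpa [w₄, w₃, hij.symm] using hk r
  refine ⟨f (Function.update w₃ i h') + Q₀ * f (Function.update w₄ j k'), ?_, ?_⟩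
  · rw [map_add, map_mul, hQ, zero_mul, add_zero]
    change ev (Matrix.det (Matrix.of (Function.update w₃ i h'))) = 0
    rw [RingHom.map_det]
    refine Matrix.det_eq_zero_of_row_eq_zero j fun r => ?_
    simp [w₃, hij.symm, hk, hα, hP]
  · rw [hM]
    change f w₀ = _
    rw [e0, e1, e2, e3, e4]
    ring

variable {K : Type u} [Field K]

section General

variable {V : Type v} [AddCommGroup V] [Module K V]

theorem linForm_dvd_pencil {u z : Module.Dual K V} {w : K → V} (hu : ∀ a, u (w a) = a)
    (hz : ∀ a, z (w a) = 1) {a b : K} (h : linForm (u - a • z) ∣ linForm (u - b • z)) :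
    a = b := by
  have h1 : w a ∈ LinearMap.ker (u - a • z) := by simp [hu, hz]
  have h2 := ker_le_ker_of_linForm_dvd h h1
  simpa [hu, hz, sub_eq_zero] using h2

theorem pencil_ne_zero {u z : Module.Dual K V} {w : K → V} (hu : ∀ a, u (w a) = a)
    (hz : ∀ a, z (w a) = 1) (a : K) : u - a • z ≠ 0 := by
  intro h
  have := LinearMap.congr_fun h (w (a + 1))
  simp [hu, hz] at this

/-- The forms $u-az$ are pairwise non-associated primes: the vector $w_a$ lies in the kernel of
$u-az$ only. Disjoint products are thus coprime and unique factorization gives $m$. -/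
theorem exists_eq_of_mul_pencil_eq {u z : Module.Dual K V} {w : K → V} (hu : ∀ a, u (w a) = a)
    (hz : ∀ a, z (w a) = 1) {A B : Finset K} (hAB : Disjoint A B) {h k : PolyFun K V}
    (e : (∏ a ∈ A, linForm (u - a • z)) * h = (∏ b ∈ B, linForm (u - b • z)) * k) :
    ∃ m, h = (∏ b ∈ B, linForm (u - b • z)) * m ∧ k = (∏ a ∈ A, linForm (u - a • z)) * m := by
  have hprime : ∀ a, Prime (linForm (u - a • z)) := fun a => linForm_prime (pencil_ne_zero hu hz a)
  have hdvd : (∏ a ∈ A, linForm (u - a • z)) ∣ k := by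
    refine prod_dvd_of_prime (fun a _ => hprime a) (fun a _ b _ => linForm_dvd_pencil hu hz) ?_
    intro a ha
    refine ((hprime a).dvd_or_dvd (e ▸ (Finset.dvd_prod_of_mem _ ha).mul_right h)).resolve_left ?_
    intro hd
    obtain ⟨b, hb, hd⟩ := (hprime a).exists_mem_finset_dvd hd
    have hab := linForm_dvd_pencil hu hz hd
    exact Finset.disjoint_left.1 hAB ha (hab ▸ hb)
  obtain ⟨m, rfl⟩ := hdvd
  refine ⟨m, ?_, rfl⟩
  have h0 : (∏ a ∈ A, linForm (u - a • z)) ≠ 0 :=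
    Finset.prod_ne_zero_iff.2 fun a _ => (hprime a).ne_zero
  apply mul_left_cancel₀ h0
  rw [e]; ring

/-- The derivation $\theta-\zeta\cdot(\text{Euler derivation})$ kills $z$, so on each pencil it
takes a value independent of $a$, divisible by the whole product. Modulo $u-v$ the two products
$P,Q$ share the factors indexed by $A\cap B$; cancelling them in $Ph\equiv Qk$ leaves coprime
products, and this crosses the two differences: $h$ gets $B\setminus A$ and $k$ gets $A\setminus B$.
-/
theorem exists_decomposition {u v z : Module.Dual K V} {w : K → V} (hu : ∀ a, u (w a) = a)
    (hv : ∀ a, v (w a) = a) (hz : ∀ a, z (w a) = 1) {A B : Finset K} [DecidableEq K]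
    {θ : Der K V} (hθz : linForm z ∣ θ (linForm z))
    (hθA : ∀ a ∈ A, linForm (u - a • z) ∣ θ (linForm (u - a • z)))
    (hθB : ∀ b ∈ B, linForm (v - b • z) ∣ θ (linForm (v - b • z)))
    (hθ : linForm (u - v) ∣ θ (linForm (u - v))) :
    ∃ ζ h k h' k' m : PolyFun K V, θ (linForm z) = linForm z * ζ ∧
      θ (linForm u) = (∏ a ∈ A, linForm (u - a • z)) * h + linForm u * ζ ∧
      θ (linForm v) = (∏ b ∈ B, linForm (v - b • z)) * k + linForm v * ζ ∧
      h = linForm (u - v) * h' + (∏ b ∈ B \ A, linForm (v - b • z)) * m ∧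
      k = linForm (u - v) * k' + (∏ a ∈ A \ B, linForm (u - a • z)) * m := by
  obtain ⟨ζ, hζ⟩ := hθz
  have hpencil : ∀ (x : Module.Dual K V) (C : Finset K), (∀ a, x (w a) = a) →
      (∀ a ∈ C, linForm (x - a • z) ∣ θ (linForm (x - a • z))) →
      ∃ h, θ (linForm x) = (∏ a ∈ C, linForm (x - a • z)) * h + linForm x * ζ := by
    intro x C hx hC
    have hd : ∏ a ∈ C, linForm (x - a • z) ∣ θ (linForm x) - linForm x * ζ := by
      refine prod_dvd_of_prime (fun a _ => linForm_prime (pencil_ne_zero hx hz a))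
        (fun a _ b _ => linForm_dvd_pencil hx hz) fun a ha => ?_
      have h1 := dvd_sub (hC a ha) (dvd_mul_right (linForm (x - a • z)) ζ)
      have h2 : θ (linForm (x - a • z)) - linForm (x - a • z) * ζ =
          θ (linForm x) - linForm x * ζ := by
        have h3 := der_linForm_smul θ a z
        have h4 := linForm_smul a z
        simp only [linForm, map_sub] at h3 h4 hζ ⊢
        rw [h3, h4, hζ]
        ring
      rwa [h2] at h1
    obtain ⟨h, hh⟩ := hd
    exact ⟨h, by rw [← hh]; ring⟩
  obtain ⟨h, hh⟩ := hpencil u A hu hθA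
  obtain ⟨k, hk⟩ := hpencil v B hv hθB
  have hα : linForm (u - v) ∣ (∏ a ∈ A, linForm (u - a • z)) * h -
      (∏ b ∈ B, linForm (v - b • z)) * k := by
    have h1 := dvd_sub hθ (dvd_mul_right (linForm (u - v)) ζ)
    convert h1 using 1
    have h2 : linForm (u - v) = linForm u - linForm v := map_sub _ _ _
    rw [h2, map_sub, hh, hk]
    ring
  have hmem : ∀ a, w a ∈ LinearMap.ker (u - v) := fun a => by simp [hu, hv]
  let D : Module.Dual K V →ₗ[K] Module.Dual K (LinearMap.ker (u - v)) :=
    (LinearMap.ker (u - v)).subtype.dualMap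
  have hDuv : D v = D u := by
    have : D (u - v) = 0 := dualMap_subtype_eq_zero_iff.2 le_rfl
    rw [map_sub, sub_eq_zero] at this
    exact this.symm
  have hDu : ∀ a, D u ⟨w a, hmem a⟩ = a := hu
  have hDz : ∀ a, D z ⟨w a, hmem a⟩ = 1 := hz
  have hres : ∀ (x : Module.Dual K V) (C : Finset K),
      res (LinearMap.ker (u - v)) (∏ a ∈ C, linForm (x - a • z)) =
        ∏ a ∈ C, linForm (D x - a • D z) := by
    intro x C
    rw [map_prod]
    refine Finset.prod_congr rfl fun a _ => ?_
    rw [res_linForm, map_sub, map_smul]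
  have hcancel : (∏ a ∈ A \ B, linForm (D u - a • D z)) * res _ h =
      (∏ b ∈ B \ A, linForm (D u - b • D z)) * res _ k := by
    have h0 : (∏ a ∈ A ∩ B, linForm (D u - a • D z)) ≠ 0 :=
      Finset.prod_ne_zero_iff.2 fun a _ => (linForm_prime (pencil_ne_zero hDu hDz a)).ne_zero
    apply mul_left_cancel₀ h0
    have h1 := res_eq_zero_iff.2 hα
    rw [map_sub, map_mul, map_mul, hres, hres, hDuv, sub_eq_zero,
      ← Finset.prod_inter_mul_prod_sdiff A B, ← Finset.prod_inter_mul_prod_sdiff B A,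
      Finset.inter_comm B A] at h1
    rw [← mul_assoc, h1, mul_assoc]
  obtain ⟨m', hm1, hm2⟩ := exists_eq_of_mul_pencil_eq hDu hDz disjoint_sdiff_sdiff hcancel
  obtain ⟨m, rfl⟩ := res_surjective _ m'
  have hh' : linForm (u - v) ∣ h - (∏ b ∈ B \ A, linForm (v - b • z)) * m := by
    rw [← res_eq_zero_iff, map_sub, map_mul, hres, hm1, hDuv, sub_self]
  have hk' : linForm (u - v) ∣ k - (∏ a ∈ A \ B, linForm (u - a • z)) * m := by
    rw [← res_eq_zero_iff, map_sub, map_mul, hres, hm2, sub_self]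
  obtain ⟨h', hh'⟩ := hh'
  obtain ⟨k', hk'⟩ := hk'
  exact ⟨ζ, h, k, h', k', m, hζ, hh, hk, by rw [← hh']; ring, by rw [← hk']; ring⟩

/-- If, locally at a point `p`, an arrangement is given by `z`, by two incomparable pencils
`u - a z` and `v - b z` and by `u - v`, then it is not free. -/
theorem not_isFreeArrangement {ι : Type*} [Fintype ι] [DecidableEq ι] {A : Set (Submodule K V)}
    (hA : IsCentralArrangement A) (y : Module.Basis ι K (Module.Dual K V)) {c i j : ι}
    (hci : c ≠ i) (hcj : c ≠ j) (hij : i ≠ j) {w : K → V} (hu : ∀ a, y i (w a) = a)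
    (hv : ∀ a, y j (w a) = a) (hz : ∀ a, y c (w a) = 1) {B C : Finset K} (hBC : ¬ B ⊆ C)
    (hCB : ¬ C ⊆ B) (hcA : LinearMap.ker (y c) ∈ A)
    (hB : ∀ a ∈ B, LinearMap.ker (y i - a • y c) ∈ A)
    (hC : ∀ a ∈ C, LinearMap.ker (y j - a • y c) ∈ A) (hijA : LinearMap.ker (y i - y j) ∈ A)
    {p : V} (hcp : y c p = 0) (hip : y i p = 0) (hjp : y j p = 0)
    (hp : ∀ H ∈ A, p ∈ H → H = LinearMap.ker (y c) ∨ (∃ a ∈ B, H = LinearMap.ker (y i - a • y c)) ∨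
      (∃ a ∈ C, H = LinearMap.ker (y j - a • y c)) ∨ H = LinearMap.ker (y i - y j)) :
    ¬ IsFreeArrangement A := by
  classical
  intro hfree
  have : Module.Free (PolyFun K V) (logDer A) := hfree
  obtain ⟨e⟩ := nonempty_equiv_of_basis hA y (Module.Free.chooseBasis (PolyFun K V) (logDer A))
  let b := (Module.Free.chooseBasis (PolyFun K V) (logDer A)).reindex e
  obtain ⟨k, hk, hdet⟩ := exists_det_eq hA y b
  have hdec := fun r => exists_decomposition (θ := (b r : Der K V)) hu hv hz
    ((b r).2 _ hcA) (fun a ha => (b r).2 _ (hB a ha)) (fun a ha => (b r).2 _ (hC a ha))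
    ((b r).2 _ hijA)
  choose ζ f g f' g' m h1 h2 h3 h4 h5 using hdec
  have hev : ∀ (s t : Finset K) (x : ι), y x p = 0 → ¬ s ⊆ t →
      evalPoint p (∏ a ∈ s \ t, linForm (y x - a • y c)) = 0 := by
    intro s t x hx hst
    obtain ⟨a, ha⟩ := Finset.sdiff_nonempty.2 hst
    rw [map_prod]
    refine Finset.prod_eq_zero ha ?_
    rw [evalPoint_linForm]
    simp [hx, hcp]
  obtain ⟨q, hq, hdet'⟩ := exists_det_eq_mul (evalPoint p : PolyFun K V →ₐ[K] K).toRingHom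
    (M := coefMat y fun r => (b r : Der K V)) hci hcj hij h1 h2 h3 h4 h5
    (by change evalPoint p _ = 0; rw [evalPoint_linForm]; simp [hip, hjp])
    (hev _ _ _ hip hBC) (hev _ _ _ hjp hCB)
  change evalPoint p q = 0 at hq
  -- Split the defining polynomial into the hyperplanes through $p$ and the rest. The first factor
  -- divides $zPQ\alpha$ and cancels; at $p$ the rest times a unit is nonzero, while the other side
  -- has the factor $q(p)=0$.
  rw [hdet, ← Finset.prod_filter_mul_prod_filter_not _ (fun H => p ∈ H)] at hdet'
  have hcoat : ∀ H ∈ hA.1.toFinset, IsCoatom H := fun H hH => hA.2 H (hA.1.mem_toFinset.1 hH)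
  have hdvd : ∏ H ∈ hA.1.toFinset with p ∈ H, linForm (defForm H) ∣
      linForm (y c) * (∏ a ∈ B, linForm (y i - a • y c)) * (∏ a ∈ C, linForm (y j - a • y c)) *
        linForm (y i - y j) := by
    refine prod_defForm_dvd (fun H hH => hcoat H (Finset.mem_filter.1 hH).1) fun H hH => ?_
    obtain ⟨hH, hpH⟩ := Finset.mem_filter.1 hH
    have hH := hA.1.mem_toFinset.1 hH
    have hker := ker_defForm (hA.2 H hH)
    have key : ∀ α : Module.Dual K V, H = LinearMap.ker α → linForm (defForm H) ∣ linForm α :=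
      fun α hα => linForm_dvd_of_ker_le (hker.trans hα).le
    rcases hp H hH hpH with h | ⟨a, ha, h⟩ | ⟨a, ha, h⟩ | h
    · exact (((key _ h).mul_right _).mul_right _).mul_right _
    · exact ((((key _ h).trans (Finset.dvd_prod_of_mem (fun a => linForm (y i - a • y c)) ha)).mul_left _).mul_right _).mul_right _
    · exact (((key _ h).trans (Finset.dvd_prod_of_mem (fun a => linForm (y j - a • y c)) ha)).mul_left _).mul_right _
    · exact (key _ h).mul_left _
  obtain ⟨t, ht⟩ := hdvd
  rw [ht, mul_assoc, mul_assoc] at hdet'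
  have h0 : ∏ H ∈ hA.1.toFinset with p ∈ H, linForm (defForm H) ≠ 0 :=
    prod_defForm_ne_zero fun H hH => hcoat H (Finset.mem_filter.1 hH).1
  have h6 := congrArg (evalPoint p) (mul_left_cancel₀ h0 hdet')
  rw [map_mul, map_mul, hq, mul_zero, map_prod] at h6
  rcases mul_eq_zero.1 h6 with h6 | h6
  · obtain ⟨H, hH, h7⟩ := Finset.prod_eq_zero_iff.1 h6
    obtain ⟨hH, hpH⟩ := Finset.mem_filter.1 hH
    rw [evalPoint_linForm, ← LinearMap.mem_ker, ker_defForm (hcoat H hH)] at h7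
    exact hpH h7
  · exact (hk.map (evalPoint p)).ne_zero h6

end General

variable {ℓ : ℕ}

/-- Sort the indices by cardinality: for comparable finite sets this is the order of inclusion. -/
theorem isNest_of_total {K : Type*} {N : Set.Icc 2 ℓ → Finset K} (h : ∀ i j, N i ⊆ N j ∨ N j ⊆ N i) :
    IsNest N := by
  let e := Fintype.orderIsoFinOfCardEq (Set.Icc 2 ℓ) rfl
  let s := Tuple.sort fun i => (N (e i)).card
  refine ⟨e.toEquiv.permCongr s, fun i j hij => ?_⟩
  have hle := Tuple.monotone_sort (fun i => (N (e i)).card) (e.symm.monotone hij)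
  change N (e (s (e.symm i))) ⊆ N (e (s (e.symm j)))
  rcases h (e (s (e.symm i))) (e (s (e.symm j))) with h' | h'
  · exact h'
  · exact (Finset.eq_of_subset_of_card_le h' hle).ge

/-- The change of coordinates that replaces `x_i`, `x_j` by `x_1 - x_i`, `x_1 - x_j`. -/
theorem exists_basis_pencils (i j : Set.Icc 2 ℓ) :
    ∃ y : Module.Basis (Set.Icc 1 ℓ ⊕ Unit) K (Module.Dual K ((Set.Icc 1 ℓ → K) × K)),
      y (Sum.inr ()) = LinearMap.snd K _ K ∧ ∀ k : Set.Icc 2 ℓ, k = i ∨ k = j →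
        y (Sum.inl ⟨k.1, Set.mem_Icc.2 ⟨le_trans one_le_two k.2.1, k.2.2⟩⟩) =
          (xOne k - xTail k) ∘ₗ LinearMap.fst K _ K := by
  classical
  let o : Set.Icc 1 ℓ := ⟨1, Set.mem_Icc.2 ⟨le_refl 1, le_trans (le_trans one_le_two i.2.1) i.2.2⟩⟩
  let T : ((Set.Icc 1 ℓ → K) × K) →ₗ[K] ((Set.Icc 1 ℓ → K) × K) :=
    { toFun := fun v => (fun k => if k.1 = i.1 ∨ k.1 = j.1 then v.1 o - v.1 k else v.1 k, v.2)
      map_add' := fun v w => by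
        ext k
        · simp only [Prod.fst_add, Pi.add_apply]
          split_ifs
          · ring
          · rfl
        · rfl
      map_smul' := fun a v => by
        ext k
        · simp only [Prod.smul_fst, Pi.smul_apply, smul_eq_mul, RingHom.id_apply]
          split_ifs
          · ring
          · rfl
        · rfl }
  have ho : ¬ (o.1 = i.1 ∨ o.1 = j.1) := by
    have h1 := i.2.1
    have h2 := j.2.1
    change ¬ (1 = i.1 ∨ 1 = j.1)
    omega
  have hT : Function.Involutive T := by
    intro v
    ext k
    · simp only [T, LinearMap.coe_mk, AddHom.coe_mk, if_neg ho]
      split_ifs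
      · ring
      · rfl
    · rfl
  let b := ((Pi.basisFun K (Set.Icc 1 ℓ)).prod (Module.Basis.singleton Unit K)).map
    (LinearEquiv.ofInvolutive T hT)
  refine ⟨b.dualBasis, ?_, ?_⟩
  · refine LinearMap.ext fun v => ?_
    rw [Module.Basis.coe_dualBasis, Module.Basis.coord_apply]
    change (((Pi.basisFun K (Set.Icc 1 ℓ)).prod (Module.Basis.singleton Unit K)).repr
      (T v)) _ = _
    simp [T]
  · intro k hk
    have hk' : k.1 = i.1 ∨ k.1 = j.1 := hk.imp (congrArg _) (congrArg _)
    refine LinearMap.ext fun v => ?_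
    rw [Module.Basis.coe_dualBasis, Module.Basis.coord_apply]
    change (((Pi.basisFun K (Set.Icc 1 ℓ)).prod (Module.Basis.singleton Unit K)).repr
      (T v)) _ = _
    simp [T, hk', xOne, xTail, coord, o]

theorem isNest_of_isFreeArrangement [CharZero K] {N : Set.Icc 2 ℓ → Finset K}
    (hfree : IsFreeArrangement (coneNIsh N)) : IsNest N := by
  classical
  refine isNest_of_total fun i j => ?_
  by_contra hcon
  rw [not_or] at hcon
  have hne : i ≠ j := by rintro rfl; exact hcon.1 subset_rfl
  obtain ⟨y, hyc, hy⟩ := exists_basis_pencils (K := K) i j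
  have hyi := hy i (Or.inl rfl)
  have hyj := hy j (Or.inr rfl)
  have hmem := mem_coneNIsh_iff_of_injective N (pos := Subtype.val) Subtype.val_injective
  have hdiff : LinearMap.ker ((xOne i - xTail i) ∘ₗ LinearMap.fst K (Set.Icc 1 ℓ → K) K -
      (xOne j - xTail j) ∘ₗ LinearMap.fst K (Set.Icc 1 ℓ → K) K) = hypDiff i j := by
    ext v
    rw [mem_hypDiff]
    have : xOne i v.1 = xOne j v.1 := rfl
    rw [LinearMap.mem_ker, LinearMap.sub_apply, LinearMap.comp_apply, LinearMap.comp_apply,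
      LinearMap.fst_apply, LinearMap.sub_apply, LinearMap.sub_apply, this, sub_sub_sub_cancel_left,
      sub_eq_zero, eq_comm]
  -- Points of the affine chart $z=1$ on which both pencil coordinates $x_1-x_i$ and $x_1-x_j$ equal
  -- $a$.
  let w : K → (Set.Icc 1 ℓ → K) × K := fun a => (fun k => if k.1 = 1 then 0 else -a, 1)
  have hw : ∀ (k : Set.Icc 2 ℓ) (a : K),
      ((xOne k - xTail k) ∘ₗ LinearMap.fst K _ K) (w a) = a := by
    intro k a
    have : (k : ℕ) ≠ 1 := by have := k.2.1; omega
    simp [xOne, xTail, coord, w, this]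
  -- The remaining $x_k$ take the values $k$, which are nonzero and distinct in characteristic $0$;
  -- hence every hyperplane through $p$ involves only $x_1,x_i,x_j,z$.
  let p : (Set.Icc 1 ℓ → K) × K :=
    (fun k => if k.1 = 1 ∨ k.1 = i.1 ∨ k.1 = j.1 then 0 else (k.1 : K), 0)
  have hpO : ∀ k : Set.Icc 2 ℓ, xOne k p.1 = 0 := fun k => by simp [xOne, coord, p]
  have hpT : ∀ k : Set.Icc 2 ℓ, xTail k p.1 = if k = i ∨ k = j then 0 else ((k : ℕ) : K) := by
    intro k
    have : (k : ℕ) ≠ 1 := by have := k.2.1; omega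
    simp [xTail, coord, p, this, Subtype.ext_iff]
  have hpT0 : ∀ k : Set.Icc 2 ℓ, xTail k p.1 = 0 ↔ k = i ∨ k = j := by
    intro k
    have : ((k : ℕ) : K) ≠ 0 := Nat.cast_ne_zero.2 (by have := k.2.1; omega)
    rw [hpT, ite_eq_left_iff]
    tauto
  have hsum : ∀ {k m : Set.Icc 2 ℓ}, k ≠ m → (Sum.inl ⟨k.1, Set.mem_Icc.2
      ⟨le_trans one_le_two k.2.1, k.2.2⟩⟩ : Set.Icc 1 ℓ ⊕ Unit) ≠ Sum.inl ⟨m.1, Set.mem_Icc.2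
      ⟨le_trans one_le_two m.2.1, m.2.2⟩⟩ := by
    intro k m hkm h
    have := Sum.inl_injective h
    exact hkm (Subtype.ext (by simpa using this))
  refine not_isFreeArrangement (isCentralArrangement_coneNIsh N) y (Sum.inr_ne_inl)
    (Sum.inr_ne_inl) (hsum hne) (w := w) (p := p) (fun a => by rw [hyi]; exact hw i a)
    (fun a => by rw [hyj]; exact hw j a)
    (fun a => by rw [hyc]; rfl) hcon.1 hcon.2 ?_ ?_ ?_ ?_ ?_ ?_ ?_ ?_ hfree
  · rw [hyc, hmem]
    exact Or.inl rfl
  · intro a ha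
    rw [hyc, hyi, hmem]
    exact Or.inr (Or.inl ⟨i, a, ha, rfl⟩)
  · intro a ha
    rw [hyc, hyj, hmem]
    exact Or.inr (Or.inl ⟨j, a, ha, rfl⟩)
  · rw [hyi, hyj, hdiff, hmem]
    rcases lt_or_gt_of_ne hne with h | h
    · exact Or.inr (Or.inr ⟨j, i, h, hypDiff_comm i j⟩)
    · exact Or.inr (Or.inr ⟨i, j, h, rfl⟩)
  · rw [hyc]; rfl
  · rw [hyi]
    simpa [hpO] using (hpT0 i).2 (Or.inl rfl)
  · rw [hyj]
    simpa [hpO] using (hpT0 j).2 (Or.inr rfl)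
  · intro H hH hpH
    rw [hyc, hyi, hyj, hdiff]
    rcases (hmem H).1 hH with rfl | ⟨k, a, ha, rfl⟩ | ⟨k, m, hmk, rfl⟩
    · exact Or.inl rfl
    · rw [mem_hypOne, hpO, zero_sub, mul_zero, neg_eq_zero, hpT0] at hpH
      rcases hpH with rfl | rfl
      · exact Or.inr (Or.inl ⟨a, ha, rfl⟩)
      · exact Or.inr (Or.inr (Or.inl ⟨a, ha, rfl⟩))
    · have hkm : k ≠ m := fun he => by rw [he] at hmk; exact lt_irrefl _ hmk
      rw [mem_hypDiff] at hpH
      by_cases hk : k = i ∨ k = j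
      · have hm := (hpT0 m).1 (hpH ▸ (hpT0 k).2 hk)
        refine Or.inr (Or.inr (Or.inr ?_))
        rcases hk with rfl | rfl <;> rcases hm with rfl | rfl
        · exact absurd rfl hkm
        · rfl
        · exact hypDiff_comm _ _
        · exact absurd rfl hkm
      · have hm : ¬ (m = i ∨ m = j) := fun hm => hk ((hpT0 k).1 (hpH.trans ((hpT0 m).2 hm)))
        rw [hpT, hpT, if_neg hk, if_neg hm] at hpH
        exact absurd (Subtype.ext (Nat.cast_injective hpH)) hkm

end NotNest

/-! ### Bases of submodules, degrees of coefficients, restriction of logarithmic derivations. -/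

section Addition

universe u v

variable {K : Type u} [Field K] {V : Type v} [AddCommGroup V] [Module K V]

/-- Independent vectors supported on the basis elements in $t$ stay independent after projection to
$R^t$. -/
theorem card_le_card_of_repr_eq_zero {R M κ τ : Type*} [CommRing R] [Nontrivial R]
    [AddCommGroup M] [Module R M] [Fintype κ] (b : Module.Basis κ R M) {s : Finset τ} {v : τ → M}
    (hv : ∀ g : τ → R, ∑ j ∈ s, g j • v j = 0 → ∀ j ∈ s, g j = 0) {t : Finset κ}
    (ht : ∀ j ∈ s, ∀ k, k ∉ t → b.repr (v j) k = 0) : s.card ≤ t.card := by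
  classical
  let p : M →ₗ[R] (t → R) := LinearMap.pi fun k => b.coord k
  have hli : LinearIndependent R fun j : s => p (v j) := by
    rw [Fintype.linearIndependent_iff]
    intro g hg
    let G : τ → R := fun j => if h : j ∈ s then g ⟨j, h⟩ else 0
    have hG : ∀ j : s, G j = g j := fun j => dif_pos j.2
    have hsum : ∑ j ∈ s, G j • v j = ∑ j : s, g j • v j := by
      rw [← Finset.sum_coe_sort s]
      exact Finset.sum_congr rfl fun j _ => by rw [hG]
    have h0 : ∑ j ∈ s, G j • v j = 0 := by
      rw [hsum]
      apply b.repr.injective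
      ext k
      by_cases hk : k ∈ t
      · have := congrFun hg ⟨k, hk⟩
        simpa [p, Finset.sum_apply] using this
      · simp only [map_sum, map_smul, Finsupp.coe_finsetSum, Finset.sum_apply, Finsupp.smul_apply,
          map_zero, Finsupp.zero_apply]
        exact Finset.sum_eq_zero fun j _ => by rw [ht j j.2 k hk, smul_zero]
    intro j
    rw [← hG]
    exact hv G h0 j j.2
  have := hli.fintype_card_le_finrank
  simpa using this

/-- The algebra behind the addition theorem: a submodule given by the single congruence
$g_{i_0}+\sum_j g_jf_j\equiv 0$ modulo $a$ has the basis $a\,b_{i_0}$ and $b_j-f_jb_{i_0}$ for $j\ne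
i_0$. -/
theorem exists_basis_of_coord_condition {R M κ : Type*} [CommRing R] [IsDomain R]
    [AddCommGroup M] [Module R M] [Fintype κ] [DecidableEq κ] {N N' : Submodule R M} (hle : N ≤ N')
    (b : Module.Basis κ R N') {i₀ : κ} {a : R} (ha : a ≠ 0) {f : κ → R} (hf : f i₀ = 0)
    (hN : ∀ g : κ → R, ∑ j, g j • (b j : M) ∈ N ↔ a ∣ g i₀ + ∑ j, g j * f j) :
    ∃ v : Module.Basis κ R N, ∀ j,
      (v j : M) = (if j = i₀ then a else 1) • (b j : M) - f j • (b i₀ : M) := by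
  let w : κ → M := fun j => (if j = i₀ then a else 1) • (b j : M) - f j • (b i₀ : M)
  have hcomb : ∀ g : κ → R, ∑ j, g j • w j =
      ∑ j, (if j = i₀ then g i₀ * a - ∑ k, g k * f k else g j) • (b j : M) := by
    intro g
    have h1 : ∀ j, (if j = i₀ then g i₀ * a - ∑ k, g k * f k else g j) • (b j : M) =
        (g j * if j = i₀ then a else 1) • (b j : M) -
          (if j = i₀ then ∑ k, g k * f k else 0) • (b j : M) := by
      intro j
      rw [← sub_smul]
      split_ifs with h
      · rw [h]
      · simp
    simp_rw [h1, Finset.sum_sub_distrib, ite_smul, zero_smul]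
    rw [Finset.sum_ite_eq' Finset.univ i₀, if_pos (Finset.mem_univ _), Finset.sum_smul,
      ← Finset.sum_sub_distrib]
    refine Finset.sum_congr rfl fun j _ => ?_
    simp only [w, smul_sub, smul_smul]
  have hw : ∀ j, w j ∈ N := by
    intro j
    have h1 : w j = ∑ k, ((if k = j then (if j = i₀ then a else 1) else 0) -
        if k = i₀ then f j else 0) • (b k : M) := by
      simp [w, sub_smul, ite_smul, Finset.sum_sub_distrib]
    rw [h1, hN]
    simp only [sub_mul, ite_mul, zero_mul, Finset.sum_sub_distrib, Finset.sum_ite_eq',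
      Finset.mem_univ, if_true, hf, mul_zero, sub_zero]
    by_cases hj : j = i₀
    · subst hj
      simp [hf]
    · simp [hj, Ne.symm hj]
  have hbli : ∀ g : κ → R, ∑ j, g j • (b j : M) = 0 → ∀ j, g j = 0 := by
    intro g hg
    have : ∑ j, g j • b j = 0 := by
      apply Subtype.ext
      simpa using hg
    exact Fintype.linearIndependent_iff.1 b.linearIndependent g this
  have hli : LinearIndependent R fun j => (⟨w j, hw j⟩ : N) := by
    rw [Fintype.linearIndependent_iff]
    intro g hg
    have h1 : ∑ j, g j • w j = 0 := by simpa using congrArg Subtype.val hg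
    rw [hcomb] at h1
    have h2 := hbli _ h1
    have h3 : ∀ j, j ≠ i₀ → g j = 0 := fun j hj => by simpa [hj] using h2 j
    have h4 : ∑ k, g k * f k = 0 := by
      refine Finset.sum_eq_zero fun k _ => ?_
      by_cases hk : k = i₀
      · rw [hk, hf, mul_zero]
      · rw [h3 k hk, zero_mul]
    intro j
    by_cases hj : j = i₀
    · have := h2 i₀
      rw [if_pos rfl, h4, sub_zero] at this
      rw [hj]
      exact (mul_eq_zero.1 this).resolve_right ha
    · exact h3 j hj
  refine ⟨Module.Basis.mk hli ?_, fun j => by rw [Module.Basis.mk_apply]⟩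
  rintro ⟨x, hx⟩ -
  have hxs := congrArg Subtype.val (b.sum_repr ⟨x, hle hx⟩)
  simp only [Submodule.coe_sum, Submodule.coe_smul] at hxs
  set g := b.repr ⟨x, hle hx⟩ with hg
  obtain ⟨q, hq⟩ := (hN g).1 (hxs ▸ hx)
  have : (⟨x, hx⟩ : N) = ∑ j, (if j = i₀ then q else g j) • (⟨w j, hw j⟩ : N) := by
    apply Subtype.ext
    simp only [Submodule.coe_sum, Submodule.coe_smul]
    rw [hcomb, ← hxs]
    refine Finset.sum_congr rfl fun j _ => ?_
    congr 1
    by_cases hj : j = i₀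
    · have h5 : ∑ k, (if k = i₀ then q else g k) * f k = ∑ k, g k * f k := by
        refine Finset.sum_congr rfl fun k _ => ?_
        split_ifs with hk
        · rw [hk, hf, mul_zero, mul_zero]
        · rfl
      rw [if_pos hj, if_pos rfl, h5, mul_comm q, ← hq, hj, add_sub_cancel_right]
    · rw [if_neg hj, if_neg hj]
  rw [this]
  exact sum_mem fun j _ => Submodule.smul_mem _ _ (Submodule.subset_span ⟨j, rfl⟩)

/-! ### Homogeneous bases -/

theorem eq_zero_of_sum_smul_basis_eq_zero {R M κ : Type*} [Semiring R] [AddCommMonoid M]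
    [Module R M] [Fintype κ] (b : Module.Basis κ R M) {c : κ → R} (h : ∑ i, c i • b i = 0) (k : κ) :
    c k = 0 := by
  classical
  have := congrArg (fun y => b.repr y k) h
  simpa [Finsupp.single_apply] using this

/-- A homogeneous derivation involves only basis elements of at most its degree. -/
theorem repr_eq_zero_of_lt {A : Set (Submodule K V)} {κ : Type*} [Fintype κ]
    (b : Module.Basis κ (PolyFun K V) (logDer A)) {d : κ → ℕ}
    (hd : ∀ i, IsHomogeneousDer (b i : Der K V) (d i)) {θ : logDer A} {e : ℕ}
    (hθ : IsHomogeneousDer (θ : Der K V) e) {k : κ} (hk : e < d k) : b.repr θ k = 0 := by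
  apply degreeHom_injective
  rw [map_zero]
  ext t : 1
  rw [Polynomial.coeff_zero]
  -- The coefficients of the part of $\theta=\sum_i r_ib_i$ of degree $d_k+t$. It vanishes as
  -- $d_k+t>e$, and its $k$-th coefficient is the degree $t$ component of $r_k$.
  let c : κ → PolyFun K V := fun i =>
    if d i ≤ d k + t then (degreeHom (b.repr θ i)).coeff (d k + t - d i) else 0
  have hc : ∑ i, c i • b i = 0 := by
    apply Subtype.ext
    refine der_ext fun α => ?_
    rw [← derEval_apply, ← derEval_apply]
    simp only [Submodule.coe_sum, Submodule.coe_smul, map_sum, map_smul, smul_eq_mul,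
      derEval_apply, ZeroMemClass.coe_zero, map_zero]
    have h1 := congrArg (derEval α ∘ₗ (logDer A).subtype) (b.sum_repr θ)
    simp only [map_sum, map_smul, smul_eq_mul, LinearMap.comp_apply, Submodule.subtype_apply,
      derEval_apply] at h1
    have h2 := isHomogeneousDer_iff.1 hθ α
    unfold IsHomog at h2
    rw [← h1] at h2
    have h3 := congrArg (fun P => Polynomial.coeff P (d k + t)) h2
    simp only [Polynomial.coeff_C_mul_X_pow] at h3
    rw [if_neg (by omega), map_sum, Polynomial.finsetSum_coeff] at h3
    rw [← h3]
    refine Finset.sum_congr rfl fun i _ => ?_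
    have h4 := isHomogeneousDer_iff.1 (hd i) α
    unfold IsHomog at h4
    rw [map_mul, h4, ← mul_assoc, Polynomial.coeff_mul_X_pow']
    simp only [c]
    split_ifs
    · rw [Polynomial.coeff_mul_C]
    · rw [zero_mul]
  have := eq_zero_of_sum_smul_basis_eq_zero b hc k
  rwa [show c k = _ from if_pos (Nat.le_add_right _ _), Nat.add_sub_cancel_left] at this

/-! ### Restriction of logarithmic derivations -/

theorem res_eq_zero_iff_of_ker_eq {H : Submodule K V} {α : Module.Dual K V}
    (h : LinearMap.ker α = H) {f : PolyFun K V} : res H f = 0 ↔ linForm α ∣ f := by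
  subst h
  exact res_eq_zero_iff

/-- Since $\theta(\alpha_H)\in\alpha_HS$, the derivation descends to the quotient $S/\alpha_HS$, the
polynomial functions on $H$. -/
theorem exists_resDer {A : Set (Submodule K V)} (hA : IsCentralArrangement A) {H : Submodule K V}
    (hH : H ∈ A) {θ : Der K V} (hθ : θ ∈ logDer A) :
    ∃ η ∈ logDer (restriction A H),
      ∀ β, η (linForm (H.subtype.dualMap β)) = res H (θ (linForm β)) := by
  obtain ⟨σ, hσ⟩ := exists_dualMap_section H
  obtain ⟨η, hη⟩ := exists_der ((res H).toLinearMap ∘ₗ θ.toLinearMap ∘ₗ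
    SymmetricAlgebra.ι K (Module.Dual K V) ∘ₗ σ)
  have hη' : ∀ β, η (linForm (H.subtype.dualMap β)) = res H (θ (linForm β)) := by
    intro β
    rw [hη]
    change res H (θ (linForm (σ (H.subtype.dualMap β)))) = _
    rw [← sub_eq_zero, ← map_sub, ← map_sub, linForm, linForm, ← map_sub]
    have hker := ker_defForm (hA.2 H hH)
    have : LinearMap.ker (defForm H) ≤ LinearMap.ker (σ (H.subtype.dualMap β) - β) := by
      rw [hker, ← dualMap_subtype_eq_zero_iff, map_sub, hσ, sub_self]
    obtain ⟨c, hc⟩ := exists_smul_eq_of_ker_le this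
    rw [hc]
    change res H (θ (linForm (c • defForm H))) = 0
    rw [der_linForm_smul, map_mul, (res_eq_zero_iff_of_ker_eq hker).2 (hθ _ (hker.symm ▸ hH)),
      mul_zero]
  refine ⟨η, ?_, hη'⟩
  rintro γ ⟨H', ⟨hH', -⟩, hker⟩
  refine linForm_dvd_der_of_ker_eq (α := H.subtype.dualMap (defForm H')) ?_ ?_
  · rw [hker]
    conv_rhs => rw [← ker_defForm (hA.2 H' hH')]
    rfl
  · rw [hη', ← res_linForm]
    exact map_dvd (res H) (hθ _ ((ker_defForm (hA.2 H' hH')).symm ▸ hH'))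

theorem IsHomogeneousDer.of_res {H : Submodule K V} {θ : Der K V} {η : Der K H} {d : ℕ}
    (hθ : IsHomogeneousDer θ d)
    (h : ∀ β, η (linForm (H.subtype.dualMap β)) = res H (θ (linForm β))) :
    IsHomogeneousDer η d := by
  obtain ⟨σ, hσ⟩ := exists_dualMap_section H
  rw [isHomogeneousDer_iff] at *
  intro γ
  rw [← hσ γ, h]
  exact (hθ _).res H

theorem mem_logDer_of_diff {A : Set (Submodule K V)} (hA : IsCentralArrangement A)
    {H : Submodule K V} {θ : Der K V} (hθ : θ ∈ logDer (A \ {H}))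
    (h : linForm (defForm H) ∣ θ (linForm (defForm H))) : θ ∈ logDer A := by
  rw [mem_logDer_iff hA.2]
  intro H' hH'
  by_cases he : H' = H
  · rw [he]; exact h
  · exact (mem_logDer_iff (hA.delete H).2).1 hθ H' ⟨hH', he⟩

theorem logDer_mono {A B : Set (Submodule K V)} (h : B ⊆ A) : logDer A ≤ logDer B :=
  fun _ hθ α hα => hθ α (h hα)

/-- A relation lifts to a combination $\alpha_H\theta'$ of the $b_j$. The other defining forms are
prime to $\alpha_H$, so $\theta'$ is again in $D(\mathcal A')$, and uniqueness of coefficients makes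
those of the lift divisible by $\alpha_H$, i.e. zero on $H$. -/
theorem resDer_linearIndependent [FiniteDimensional K V] {A : Set (Submodule K V)}
    (hA : IsCentralArrangement A) {H : Submodule K V} (hH : H ∈ A) {κ : Type*} [Fintype κ]
    (b : Module.Basis κ (PolyFun K V) (logDer (A \ {H}))) {s : Finset κ} {η : κ → Der K H}
    (hη : ∀ j ∈ s, ∀ β, η j (linForm (H.subtype.dualMap β)) = res H ((b j : Der K V) (linForm β)))
    (g : κ → PolyFun K H) (hg : ∑ j ∈ s, g j • η j = 0) : ∀ j ∈ s, g j = 0 := by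
  classical
  have hker := ker_defForm (hA.2 H hH)
  choose G hG using fun j => res_surjective H (g j)
  let θ : Der K V := ∑ j ∈ s, G j • (b j : Der K V)
  have hθ : ∀ β, linForm (defForm H) ∣ θ (linForm β) := by
    intro β
    rw [← res_eq_zero_iff_of_ker_eq hker, ← derEval_apply]
    have h1 := congrArg (derEval (H.subtype.dualMap β)) hg
    simp only [map_sum, map_smul, smul_eq_mul, map_zero, derEval_apply] at h1
    simp only [θ, map_sum, map_smul, smul_eq_mul, map_mul, derEval_apply, hG]
    rw [← h1]
    exact Finset.sum_congr rfl fun j hj => by rw [hη j hj]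
  let x := Module.finBasis K (Module.Dual K V)
  choose q hq using fun i => hθ (x i)
  let θ' : Der K V := (derEquiv x).symm q
  have hθ' : θ = linForm (defForm H) • θ' := by
    apply (derEquiv x).injective
    rw [map_smul, LinearEquiv.apply_symm_apply]
    exact funext hq
  have hmem : θ' ∈ logDer (A \ {H}) := by
    rw [mem_logDer_iff (hA.delete H).2]
    rintro H' ⟨hH', hne⟩
    have h2 : θ ∈ logDer (A \ {H}) := sum_mem fun j _ => Submodule.smul_mem _ _ (b j).2
    have h3 := (mem_logDer_iff (hA.delete H).2).1 h2 H' ⟨hH', hne⟩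
    rw [hθ', Derivation.smul_apply, smul_eq_mul] at h3
    refine ((defForm_prime (hA.2 H' hH')).dvd_or_dvd h3).resolve_left fun h4 => ?_
    exact hne (eq_of_defForm_dvd (hA.2 H' hH') (hA.2 H hH) h4)
  have hrepr : ∑ j ∈ s, G j • b j = linForm (defForm H) • (⟨θ', hmem⟩ : logDer (A \ {H})) := by
    apply Subtype.ext
    simpa [θ] using hθ'
  intro j hj
  have h5 := congrArg (fun y => b.repr y j) hrepr
  simp only [map_sum, map_smul, Finsupp.coe_finsetSum, Finset.sum_apply, Finsupp.smul_apply,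
    Module.Basis.repr_self, smul_eq_mul, Finsupp.single_apply, mul_ite, mul_one, mul_zero,
    Finset.sum_ite_eq', if_pos hj] at h5
  rw [← hG, res_eq_zero_iff_of_ker_eq hker, h5]
  exact dvd_mul_right _ _

end Addition

/-! ### Terao's polynomial and the addition theorem. -/

section AdditionTheorem

universe u v

variable {K : Type u} [Field K] {V : Type v} [AddCommGroup V] [Module K V]
  {A : Set (Submodule K V)} {H : Submodule K V}

theorem ker_dualMap_defForm {H' : Submodule K V} (hH' : IsCoatom H') :
    LinearMap.ker (H.subtype.dualMap (defForm H')) = H'.comap H.subtype := by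
  conv_rhs => rw [← ker_defForm hH']
  rfl

open scoped Classical in
/-- The number of hyperplanes of `A`, other than `H`, that cut out `X` on `H`. -/
noncomputable def traceCard (hA : IsCentralArrangement A) (H : Submodule K V)
    (X : Submodule K H) : ℕ :=
  ((hA.delete H).1.toFinset.filter fun H' => H'.comap H.subtype = X).card

theorem traceCard_pos (hA : IsCentralArrangement A) {X : Submodule K H}
    (hX : X ∈ restriction A H) : 0 < traceCard hA H X := by
  obtain ⟨H', hH', rfl⟩ := hX
  exact Finset.card_pos.2 ⟨H', Finset.mem_filter.2 ⟨(hA.delete H).1.mem_toFinset.2 hH', rfl⟩⟩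

theorem sum_traceCard (hA : IsCentralArrangement A) (hH : H ∈ A) :
    ∑ X ∈ (hA.restrict hH).1.toFinset, traceCard hA H X = (hA.delete H).1.toFinset.card := by
  classical
  rw [Finset.card_eq_sum_card_fiberwise (f := fun H' => H'.comap H.subtype)
    (t := (hA.restrict hH).1.toFinset)]
  · refine Finset.sum_congr rfl fun X _ => ?_
    unfold traceCard
    congr
  · intro H' hH'
    have h1 := (hA.delete H).1.mem_toFinset.1 hH'
    exact (hA.restrict hH).1.mem_toFinset.2 ⟨H', h1, rfl⟩

/-- If $H_1$ and $H'$ both cut out $X$, then $\alpha_{H_1}$ is a combination of $\alpha_H$ and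
$\alpha_{H'}$, so $\alpha_H\theta(\alpha_{H_1})-\alpha_{H_1}\theta(\alpha_H)$ is divisible by
$\alpha_{H'}$. Restricting the product over all such $H'$ to $H$ leaves
$\alpha_{H_1}\theta(\alpha_H)$; cancelling its first factor costs one power. -/
theorem defForm_pow_dvd_res (hA : IsCentralArrangement A) (hH : H ∈ A) {X : Submodule K H}
    (hX : X ∈ restriction A H) {θ : Der K V} (hθ : θ ∈ logDer (A \ {H})) :
    linForm (defForm X) ^ (traceCard hA H X - 1) ∣ res H (θ (linForm (defForm H))) := by
  classical
  have hA' := hA.delete H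
  have hXc := (hA.restrict hH).2 X hX
  set F := hA'.1.toFinset.filter fun H' => H'.comap H.subtype = X with hF
  have hcard : traceCard hA H X = F.card := by
    unfold traceCard
    congr
  obtain ⟨H₁, hH₁⟩ := Finset.card_pos.1 (hcard ▸ traceCard_pos hA hX)
  have hFA : ∀ H' ∈ F, IsCoatom H' ∧ H' ∈ A \ {H} ∧
      LinearMap.ker (H.subtype.dualMap (defForm H')) = LinearMap.ker (defForm X) := by
    intro H' hH'
    obtain ⟨h1, h2⟩ := Finset.mem_filter.1 hH'
    have h1 := hA'.1.mem_toFinset.1 h1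
    exact ⟨hA'.2 H' h1, h1, by rw [ker_dualMap_defForm (hA'.2 H' h1), h2, ker_defForm hXc]⟩
  obtain ⟨hc₁, -, hk₁⟩ := hFA H₁ hH₁
  have hdvd : ∏ H' ∈ F, linForm (defForm H') ∣
      linForm (defForm H) * θ (linForm (defForm H₁)) -
        linForm (defForm H₁) * θ (linForm (defForm H)) := by
    refine prod_defForm_dvd (fun H' hH' => (hFA H' hH').1) fun H' hH' => ?_
    obtain ⟨hc', hmem, hk'⟩ := hFA H' hH'
    obtain ⟨c, hc⟩ := exists_smul_eq_of_ker_le (hk'.trans hk₁.symm).le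
    have hker : LinearMap.ker (defForm H) ≤ LinearMap.ker (defForm H₁ - c • defForm H') := by
      rw [ker_defForm (hA.2 H hH), ← dualMap_subtype_eq_zero_iff, map_sub, map_smul, hc, sub_self]
    obtain ⟨e, he⟩ := exists_smul_eq_of_ker_le hker
    rw [sub_eq_iff_eq_add] at he
    have h1 : linForm (defForm H₁) = algebraMap K _ e * linForm (defForm H) +
        algebraMap K _ c * linForm (defForm H') := by
      rw [← linForm_smul, ← linForm_smul, linForm, he, map_add]
    have h2 : θ (linForm (defForm H₁)) = algebraMap K _ e * θ (linForm (defForm H)) +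
        algebraMap K _ c * θ (linForm (defForm H')) := by
      rw [← der_linForm_smul, ← der_linForm_smul, linForm, he, map_add, map_add]
    obtain ⟨r, hr⟩ := (mem_logDer_iff hA'.2).1 hθ H' hmem
    refine ⟨algebraMap K _ c * (linForm (defForm H) * r - θ (linForm (defForm H))), ?_⟩
    rw [h2, h1, hr]
    ring
  obtain ⟨q, hq⟩ := hdvd
  have hq' := congrArg (res H) hq
  rw [map_sub, map_mul, map_mul, map_mul,
    (res_eq_zero_iff_of_ker_eq (ker_defForm (hA.2 H hH))).2 dvd_rfl, zero_mul, zero_sub, map_prod]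
    at hq'
  have h3 : linForm (defForm X) ^ F.card ∣ ∏ H' ∈ F, res H (linForm (defForm H')) := by
    rw [← Finset.prod_const]
    refine Finset.prod_dvd_prod_of_dvd _ _ fun H' hH' => ?_
    rw [res_linForm]
    exact linForm_dvd_of_ker_le (hFA H' hH').2.2.ge
  have h4 : res H (linForm (defForm H₁)) ∣ linForm (defForm X) := by
    rw [res_linForm]
    exact linForm_dvd_of_ker_le hk₁.le
  have h5 : linForm (defForm X) ^ F.card ∣
      linForm (defForm X) * res H (θ (linForm (defForm H))) := by
    refine dvd_trans ?_ (mul_dvd_mul_right h4 _)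
    rw [← dvd_neg, hq']
    exact h3.mul_right _
  rw [hcard]
  rw [← Nat.sub_add_cancel (Finset.card_pos.2 ⟨H₁, hH₁⟩), pow_succ'] at h5
  exact (mul_dvd_mul_iff_left (defForm_prime hXc).ne_zero).1 h5

/-- Terao's polynomial $B$, of degree $|\mathcal A'|-|\mathcal A''|$: each $\alpha_X$ to the number
of hyperplanes of $\mathcal A'$ over $X$, minus one. -/
theorem exists_dvd_res (hA : IsCentralArrangement A) (hH : H ∈ A) :
    ∃ (B : PolyFun K H) (e : ℕ), B ≠ 0 ∧ IsHomog B e ∧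
      e + (hA.restrict hH).1.toFinset.card = (hA.delete H).1.toFinset.card ∧
      ∀ θ ∈ logDer (A \ {H}), B ∣ res H (θ (linForm (defForm H))) := by
  have hcoat : ∀ X ∈ (hA.restrict hH).1.toFinset, X ∈ restriction A H ∧ IsCoatom X := by
    intro X hX
    have := (hA.restrict hH).1.mem_toFinset.1 hX
    exact ⟨this, (hA.restrict hH).2 X this⟩
  refine ⟨∏ X ∈ (hA.restrict hH).1.toFinset, linForm (defForm X) ^ (traceCard hA H X - 1), _,
    ?_, isHomog_prod _ fun X _ => (isHomog_linForm _).pow _, ?_, fun θ hθ => ?_⟩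
  · exact Finset.prod_ne_zero_iff.2 fun X hX => pow_ne_zero _ (defForm_prime (hcoat X hX).2).ne_zero
  · rw [← sum_traceCard hA hH, Finset.card_eq_sum_ones, ← Finset.sum_add_distrib]
    refine Finset.sum_congr rfl fun X hX => ?_
    have := traceCard_pos hA (hcoat X hX).1
    omega
  · exact prod_pow_dvd_of_prime (fun X hX => defForm_prime (hcoat X hX).2)
      (fun X hX Y hY => eq_of_defForm_dvd (hcoat X hX).2 (hcoat Y hY).2)
      fun X hX => defForm_pow_dvd_res hA hH (hcoat X hX).1 hθ

theorem HasExponents.card_and_sum [FiniteDimensional K V] (hA : IsCentralArrangement A)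
    {m : Multiset ℕ} (h : HasExponents A m) :
    m.card = Module.finrank K V ∧ m.sum = hA.1.toFinset.card := by
  obtain ⟨n, b, d, hd, rfl⟩ := h
  let x := Module.finBasis K (Module.Dual K V)
  obtain ⟨e⟩ := nonempty_equiv_of_basis hA x b
  refine ⟨?_, sum_degrees_eq hA (x.reindex e.symm) b hd⟩
  have := Fintype.card_congr e
  rw [Fintype.card_fin, Fintype.card_fin, Subspace.dual_finrank_eq] at this
  simpa using this

/-- Terao's addition theorem. -/
theorem HasExponents.addition [FiniteDimensional K V] (hA : IsCentralArrangement A) (hH : H ∈ A)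
    {m' m'' : Multiset ℕ} (h' : HasExponents (A \ {H}) m') (h'' : HasExponents (restriction A H) m'')
    (hle : m'' ≤ m') : ∃ e, m' = e ::ₘ m'' ∧ HasExponents A ((e + 1) ::ₘ m'') := by
  classical
  have hA' := hA.delete H
  have hA'' := hA.restrict hH
  have hker := ker_defForm (hA.2 H hH)
  obtain ⟨hcard', hsum'⟩ := h'.card_and_sum hA'
  obtain ⟨hcard'', hsum''⟩ := h''.card_and_sum hA''
  obtain ⟨B, e, hB0, hBe, hcard, hB⟩ := exists_dvd_res hA hH
  have hrank : Module.finrank K H + 1 = Module.finrank K V := by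
    conv_lhs => rw [← hker]
    exact Module.Dual.finrank_ker_add_one_of_ne_zero (defForm_ne_zero (hA.2 H hH))
  -- The ranks differ by one, so $m'$ has one extra exponent; by the sums it is $|\mathcal
  -- A'|-|\mathcal A''|=\deg B$.
  have hm : m' = e ::ₘ m'' := by
    obtain ⟨t, rfl⟩ := Multiset.le_iff_exists_add.1 hle
    rw [Multiset.card_add] at hcard'
    obtain ⟨a, rfl⟩ := Multiset.card_eq_one.1 (show t.card = 1 by omega)
    rw [Multiset.sum_add, Multiset.sum_singleton] at hsum'
    rw [show a = e by omega, add_comm, Multiset.singleton_add]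
  refine ⟨e, hm, ?_⟩
  obtain ⟨n, b, d, hd, hm'⟩ := h'
  obtain ⟨n'', b'', d'', hd'', hm''⟩ := h''
  have hd0 := fun i => isHomogeneousDer_iff.1 (hd i)
  choose c hc using fun i => hB (b i) (b i).2
  have hch : ∀ i, (c i = 0 ∨ e ≤ d i) ∧ IsHomog (c i) (d i - e) := fun i =>
    hBe.of_mul_left hB0 (hc i ▸ (hd0 i (defForm H)).res H)
  -- Otherwise every basis element of degree at most $e$ lies in $D(\mathcal A)$. Their restrictions
  -- are independent and lie in the span of the basis elements of $D(\mathcal A'')$ of degree at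
  -- most $e$, of which there is one fewer.
  obtain ⟨i₀, hi₀, hci₀⟩ : ∃ i, d i = e ∧ c i ≠ 0 := by
    by_contra hcon
    push Not at hcon
    have hc0 : ∀ i, d i ≤ e → c i = 0 := by
      intro i hi
      rcases hi.eq_or_lt with h | h
      · exact hcon i h
      · exact (hch i).1.resolve_right (not_le.2 h)
    have hmem : ∀ i, d i ≤ e → (b i : Der K V) ∈ logDer A := fun i hi =>
      mem_logDer_of_diff hA (b i).2 ((res_eq_zero_iff_of_ker_eq hker).1
        (by rw [hc, hc0 i hi, mul_zero]))
    have hex : ∀ i, ∃ η : logDer (restriction A H), d i ≤ e →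
        ∀ β, (η : Der K H) (linForm (H.subtype.dualMap β)) =
          res H ((b i : Der K V) (linForm β)) := by
      intro i
      by_cases hi : d i ≤ e
      · obtain ⟨η, h1, h2⟩ := exists_resDer hA hH (hmem i hi)
        exact ⟨⟨η, h1⟩, fun _ => h2⟩
      · exact ⟨0, fun h => absurd h hi⟩
    choose η hη using hex
    have hle := card_le_card_of_repr_eq_zero b'' (s := Finset.univ.filter fun i => d i ≤ e) (v := η)
      (t := Finset.univ.filter fun k => d'' k ≤ e) ?_ ?_
    · have h1 : (Finset.univ.filter fun i => d i ≤ e).card = m'.countP (· ≤ e) := by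
        rw [hm', Multiset.countP_map]
        rfl
      have h2 : (Finset.univ.filter fun k => d'' k ≤ e).card = m''.countP (· ≤ e) := by
        rw [hm'', Multiset.countP_map]
        rfl
      rw [h1, h2, hm, Multiset.countP_cons_of_pos (p := (· ≤ e)) _ le_rfl] at hle
      omega
    · intro g hg
      refine resDer_linearIndependent hA hH b (η := fun i => (η i : Der K H))
        (fun j hj => hη j (Finset.mem_filter.1 hj).2) g ?_
      have := congrArg Subtype.val hg
      simpa using this
    · intro j hj k hk
      have hj := (Finset.mem_filter.1 hj).2
      have hk : ¬ d'' k ≤ e := fun h => hk (Finset.mem_filter.2 ⟨Finset.mem_univ _, h⟩)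
      exact repr_eq_zero_of_lt b'' hd'' ((hd j).of_res (hη j hj)) (by omega)
  obtain ⟨a, ha⟩ : ∃ a : K, algebraMap K _ a = c i₀ := by
    have := (hch i₀).2
    rw [hi₀, Nat.sub_self] at this
    exact this.exists_algebraMap
  have ha0 : a ≠ 0 := fun h => hci₀ (by rw [← ha, h, map_zero])
  obtain ⟨σ, hσ⟩ := exists_dualMap_section H
  -- Lifts of $c_j/c_{i_0}$, which exist because $c_{i_0}$ is a nonzero constant. Membership in
  -- $D(\mathcal A)$ becomes one congruence modulo $\alpha_H$.
  let f : Fin n → PolyFun K V := fun j =>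
    if j = i₀ then 0 else extendBy σ (algebraMap K _ a⁻¹ * c j)
  have hf0 : f i₀ = 0 := if_pos rfl
  have hfres : ∀ j, j ≠ i₀ → c j = res H (f j) * c i₀ := by
    intro j hj
    simp only [f, if_neg hj]
    rw [res_extendBy hσ, ← ha, mul_right_comm, ← map_mul, inv_mul_cancel₀ ha0, map_one, one_mul]
  have hN : ∀ g : Fin n → PolyFun K V, ∑ j, g j • (b j : Der K V) ∈ logDer A ↔
      linForm (defForm H) ∣ g i₀ + ∑ j, g j * f j := by
    intro g
    have hmem : ∑ j, g j • (b j : Der K V) ∈ logDer (A \ {H}) :=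
      sum_mem fun j _ => Submodule.smul_mem _ _ (b j).2
    have h1 : ∑ j, g j • (b j : Der K V) ∈ logDer A ↔ linForm (defForm H) ∣
        (∑ j, g j • (b j : Der K V)) (linForm (defForm H)) :=
      ⟨fun h => (mem_logDer_iff hA.2).1 h H hH, mem_logDer_of_diff hA hmem⟩
    rw [h1, ← res_eq_zero_iff_of_ker_eq hker, ← res_eq_zero_iff_of_ker_eq hker, ← derEval_apply]
    have h2 : res H (derEval (defForm H) (∑ j, g j • (b j : Der K V))) =
        B * c i₀ * res H (g i₀ + ∑ j, g j * f j) := by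
      simp only [map_sum, map_smul, smul_eq_mul, map_mul, map_add, derEval_apply, hc]
      rw [← Finset.add_sum_erase _ _ (Finset.mem_univ i₀),
        ← Finset.add_sum_erase _ (fun x => res H (g x) * res H (f x)) (Finset.mem_univ i₀), hf0,
        map_zero, mul_zero, zero_add, mul_add, Finset.mul_sum]
      congr 1
      · ring
      · refine Finset.sum_congr rfl fun j hj => ?_
        rw [hfres j (Finset.ne_of_mem_erase hj)]
        ring
    rw [h2]
    constructor
    · exact fun h => (mul_eq_zero.1 h).resolve_left (mul_ne_zero hB0 hci₀)
    · intro h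
      rw [h, mul_zero]
  obtain ⟨v, hv⟩ := exists_basis_of_coord_condition (logDer_mono Set.sdiff_subset) b
    (defForm_prime (hA.2 H hH)).ne_zero hf0 hN
  refine ⟨n, v, fun j => if j = i₀ then e + 1 else d j, fun j => ?_, ?_⟩
  · rw [isHomogeneousDer_iff]
    intro β
    change IsHomog _ (if j = i₀ then e + 1 else d j)
    rw [hv, Derivation.sub_apply, Derivation.smul_apply, Derivation.smul_apply, smul_eq_mul,
      smul_eq_mul]
    by_cases hj : j = i₀
    · rw [if_pos hj, if_pos hj, hj, hf0, zero_mul, sub_zero, add_comm, ← hi₀]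
      exact (isHomog_linForm _).mul (hd0 i₀ β)
    · rw [if_neg hj, if_neg hj, one_mul]
      refine (hd0 j β).sub ?_
      simp only [f, if_neg hj]
      rcases (hch j).1 with h0 | hle'
      · rw [h0, mul_zero, map_zero, zero_mul]
        exact isHomog_zero _
      · have h1 : IsHomog (extendBy σ (algebraMap K _ a⁻¹ * c j)) (0 + (d j - e)) :=
          ((isHomog_algebraMap _).mul (hch j).2).extendBy σ
        have h2 := h1.mul (hd0 i₀ β)
        rwa [hi₀, zero_add, Nat.sub_add_cancel hle'] at h2
  · have huniv : (Finset.univ : Finset (Fin n)).val =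
        i₀ ::ₘ (Finset.univ.erase i₀ : Finset (Fin n)).val := by
      rw [← Finset.insert_val_of_notMem (Finset.notMem_erase _ _),
        Finset.insert_erase (Finset.mem_univ _)]
    rw [hm', huniv, Multiset.map_cons, hi₀, Multiset.cons_inj_right] at hm
    rw [huniv, Multiset.map_cons, if_pos rfl, ← hm]
    congr 1
    refine Multiset.map_congr rfl fun j hj => ?_
    rw [if_neg (Finset.ne_of_mem_erase (show j ∈ Finset.univ.erase i₀ from hj))]

theorem hasExponents_empty [FiniteDimensional K V] :
    HasExponents (∅ : Set (Submodule K V)) (Multiset.replicate (Module.finrank K V) 0) := by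
  have htop : logDer (∅ : Set (Submodule K V)) = ⊤ :=
    eq_top_iff.2 fun θ _ α hα => hα.elim
  let x := Module.finBasis K (Module.Dual K V)
  refine ⟨_, (derBasis x).map (Submodule.topEquiv.symm.trans (LinearEquiv.ofEq _ _ htop.symm)),
    fun _ => 0, fun i => ?_, ?_⟩
  · rw [isHomogeneousDer_iff]
    intro α
    change IsHomog (derBasis x i (linForm α)) 0
    rw [der_linForm_eq_sum x]
    simp only [derBasis_linForm, mul_ite, mul_one, mul_zero, Finset.sum_ite_eq, Finset.mem_univ,
      if_true]
    exact isHomog_algebraMap _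
  · simp [Subspace.dual_finrank_eq]

/-! ### Inductive freeness -/

theorem HasExponents.isFreeArrangement {m : Multiset ℕ} (h : HasExponents A m) :
    IsFreeArrangement A := by
  obtain ⟨n, b, -⟩ := h
  exact Module.Free.of_basis b

theorem IsInductivelyFree.isFreeArrangement [FiniteDimensional K V] (hA : IsCentralArrangement A)
    (h : IsInductivelyFree A) : IsFreeArrangement A := by
  cases h with
  | empty => exact hasExponents_empty.isFreeArrangement
  | add _ H hH h' h'' m' m'' hm' hm'' hle =>
    obtain ⟨e, -, he⟩ := hm'.addition hA hH hm'' hle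
    exact he.isFreeArrangement

end AdditionTheorem

/-! ### Modular levels imply inductive freeness; the main theorem. -/

section InductiveFreeness

universe u v

variable {K : Type u} [Field K]

namespace HasModularLevels

variable {V : Type v} [AddCommGroup V] [Module K V] {A : Set (Submodule K V)}
  {ρ : Submodule K V → ℕ} {H : Submodule K V}

theorem delete (hρ : HasModularLevels A ρ) (hmax : ∀ H' ∈ A, ρ H' ≤ ρ H) :
    HasModularLevels (A \ {H}) ρ := by
  constructor
  · rintro H₁ ⟨h₁, -⟩ H₂ ⟨h₂, -⟩ hne heq
    obtain ⟨H₃, h₃, hlt, hle⟩ := hρ.exists_lower H₁ h₁ H₂ h₂ hne heq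
    refine ⟨H₃, ⟨h₃, fun h => ?_⟩, hlt, hle⟩
    rw [Set.mem_singleton_iff.1 h] at hlt
    exact absurd (hmax H₁ h₁) (not_le.2 hlt)
  · rintro H₁ ⟨h₁, -⟩ hle
    exact hρ.not_sInf_le H₁ h₁ (le_trans (sInf_le_sInf fun X hX => ⟨hX.1.1, hX.2⟩) hle)

/-- Distinct $H_1,H_2$ with one trace on $H$ would satisfy $H_1\cap H_2=H\cap H_1\subseteq H$,
although both have lower level than $H$. -/
theorem eq_of_comap_eq (hA : IsCentralArrangement A) (hρ : HasModularLevels A ρ) (hH : H ∈ A)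
    {H₁ H₂ : Submodule K V} (h₁ : H₁ ∈ A) (h₂ : H₂ ∈ A) (hl₁ : ρ H₁ < ρ H) (hl₂ : ρ H₂ < ρ H)
    (h : H₁.comap H.subtype = H₂.comap H.subtype) : H₁ = H₂ := by
  by_contra hne
  have hle : H ⊓ H₁ ≤ H₂ := by
    rintro x ⟨hx, hx₁⟩
    have : (⟨x, hx⟩ : H) ∈ H₁.comap H.subtype := hx₁
    rw [h] at this
    exact this
  have h3 : H₁ ≠ H := by rintro rfl; exact lt_irrefl _ hl₁
  have := inf_eq_inf_of_isCoatom (hA.2 H hH) (hA.2 H₂ h₂) (hA.2 H₁ h₁) h3 hne hle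
  refine hρ.not_sInf_le H hH (le_trans (le_inf (sInf_le ⟨h₂, hl₂⟩) (sInf_le ⟨h₁, hl₁⟩)) ?_)
  rw [this]
  exact inf_le_left

/-- A hyperplane of the same top level as $H$ can be replaced by the lower one through its
intersection with $H$, which has the same trace. -/
theorem exists_comap_eq (hA : IsCentralArrangement A) (hρ : HasModularLevels A ρ) (hH : H ∈ A)
    (hmax : ∀ H' ∈ A, ρ H' ≤ ρ H) {X : Submodule K H} (hX : X ∈ restriction A H) :
    ∃ H₁ ∈ A, ρ H₁ < ρ H ∧ X = H₁.comap H.subtype := by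
  obtain ⟨H₁, ⟨h₁, hne⟩, rfl⟩ := hX
  have hne : H₁ ≠ H := hne
  rcases (hmax H₁ h₁).lt_or_eq with hlt | heq
  · exact ⟨H₁, h₁, hlt, rfl⟩
  · obtain ⟨H₂, h₂, hlt, hle⟩ := hρ.exists_lower H₁ h₁ H hH hne heq
    have h3 : H ≠ H₂ := by rintro rfl; exact absurd hlt (by rw [heq]; exact lt_irrefl _)
    have := inf_eq_inf_of_isCoatom (hA.2 H₁ h₁) (hA.2 H₂ h₂) (hA.2 H hH) hne.symm h3 hle
    refine ⟨H₂, h₂, heq ▸ hlt, ?_⟩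
    ext ⟨x, hx⟩
    have h4 := SetLike.ext_iff.1 this x
    simpa [hx] using h4.symm

/-- The level function induced on the restriction to a hyperplane of maximal level. -/
noncomputable def restrictLevel (A : Set (Submodule K V)) (ρ : Submodule K V → ℕ)
    (H : Submodule K V) (X : Submodule K H) : ℕ :=
  sInf {k | ∃ H' ∈ A, H' ≠ H ∧ H'.comap H.subtype = X ∧ ρ H' = k}

theorem restrictLevel_comap (hA : IsCentralArrangement A) (hρ : HasModularLevels A ρ) (hH : H ∈ A)
    {H₁ : Submodule K V} (h₁ : H₁ ∈ A) (hl₁ : ρ H₁ < ρ H) :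
    restrictLevel A ρ H (H₁.comap H.subtype) = ρ H₁ := by
  have hmem : ρ H₁ ∈ {k | ∃ H' ∈ A, H' ≠ H ∧ H'.comap H.subtype = H₁.comap H.subtype ∧ ρ H' = k} :=
    ⟨H₁, h₁, by rintro rfl; exact lt_irrefl _ hl₁, rfl, rfl⟩
  refine le_antisymm (Nat.sInf_le hmem) (le_csInf ⟨_, hmem⟩ ?_)
  rintro _ ⟨H₂, h₂, -, hc, rfl⟩
  by_contra hlt
  have hl₂ := (not_le.1 hlt).trans hl₁
  exact hlt (hρ.eq_of_comap_eq hA hH h₂ h₁ hl₂ hl₁ hc ▸ le_rfl)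

theorem restrict (hA : IsCentralArrangement A) (hρ : HasModularLevels A ρ) (hH : H ∈ A)
    (hmax : ∀ H' ∈ A, ρ H' ≤ ρ H) :
    HasModularLevels (restriction A H) (restrictLevel A ρ H) := by
  constructor
  · intro X hX Y hY hne heq
    obtain ⟨H₁, h₁, hl₁, rfl⟩ := hρ.exists_comap_eq hA hH hmax hX
    obtain ⟨H₂, h₂, hl₂, rfl⟩ := hρ.exists_comap_eq hA hH hmax hY
    rw [restrictLevel_comap hA hρ hH h₁ hl₁, restrictLevel_comap hA hρ hH h₂ hl₂] at heq
    obtain ⟨H₃, h₃, hlt, hle⟩ := hρ.exists_lower H₁ h₁ H₂ h₂ (fun h => hne (by rw [h])) heq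
    refine ⟨H₃.comap H.subtype, ⟨H₃, ⟨h₃, ?_⟩, rfl⟩, ?_, fun x hx => hle hx⟩
    · intro h
      rw [Set.mem_singleton_iff.1 h] at hlt
      exact absurd hlt (not_lt.2 hl₁.le)
    · rwa [restrictLevel_comap hA hρ hH h₁ hl₁, restrictLevel_comap hA hρ hH h₃ (hlt.trans hl₁)]
  · intro X hX hle
    obtain ⟨H₁, h₁, hl₁, rfl⟩ := hρ.exists_comap_eq hA hH hmax hX
    rw [restrictLevel_comap hA hρ hH h₁ hl₁] at hle
    obtain ⟨x, hx, hxH₁⟩ := SetLike.not_le_iff_exists.1 (hρ.not_sInf_le H₁ h₁)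
    obtain ⟨y, hy, hyH⟩ := SetLike.not_le_iff_exists.1 (hρ.not_sInf_le H hH)
    rw [Submodule.mem_sInf] at hx hy
    have hker := ker_defForm (hA.2 H hH)
    have hy0 : defForm H y ≠ 0 := by rwa [← hker] at hyH
    -- Correct $x$ by $y$ to land in $H$. As $y$ lies in every hyperplane of level below that of
    -- $H$, membership in them is unaffected.
    let c := defForm H x / defForm H y
    have hmem : x - c • y ∈ H := by
      rw [← hker, LinearMap.mem_ker, map_sub, map_smul, smul_eq_mul, div_mul_cancel₀ _ hy0,
        sub_self]
    have hin : (⟨x - c • y, hmem⟩ : H) ∈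
        sInf {Y | Y ∈ restriction A H ∧ restrictLevel A ρ H Y < ρ H₁} := by
      rw [Submodule.mem_sInf]
      rintro Y ⟨hY, hlt⟩
      obtain ⟨H₂, h₂, hl₂, rfl⟩ := hρ.exists_comap_eq hA hH hmax hY
      rw [restrictLevel_comap hA hρ hH h₂ hl₂] at hlt
      exact H₂.sub_mem (hx H₂ ⟨h₂, hlt⟩) (H₂.smul_mem _ (hy H₂ ⟨h₂, hl₂⟩))
    have h3 : x - c • y ∈ H₁ := hle hin
    exact hxH₁ ((H₁.sub_mem_iff_left (H₁.smul_mem _ (hy H₁ ⟨h₁, hl₁⟩))).1 h3)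

theorem ncard_restrict_level (hA : IsCentralArrangement A) (hρ : HasModularLevels A ρ)
    (hH : H ∈ A) (hmax : ∀ H' ∈ A, ρ H' ≤ ρ H) {k : ℕ} (hk : k ≠ ρ H) :
    {X | X ∈ restriction A H ∧ restrictLevel A ρ H X = k}.ncard =
      {H' | H' ∈ A ∧ ρ H' = k}.ncard := by
  have hlt : ∀ H' ∈ {H' | H' ∈ A ∧ ρ H' = k}, ρ H' < ρ H := fun H' hH' =>
    lt_of_le_of_ne (hmax H' hH'.1) (hH'.2 ▸ hk)
  have himage : {X | X ∈ restriction A H ∧ restrictLevel A ρ H X = k} =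
      (fun H' => H'.comap H.subtype) '' {H' | H' ∈ A ∧ ρ H' = k} := by
    ext X
    constructor
    · rintro ⟨hX, hXk⟩
      obtain ⟨H₁, h₁, hl₁, rfl⟩ := hρ.exists_comap_eq hA hH hmax hX
      rw [restrictLevel_comap hA hρ hH h₁ hl₁] at hXk
      exact ⟨H₁, ⟨h₁, hXk⟩, rfl⟩
    · rintro ⟨H₁, h₁, rfl⟩
      have hl := hlt H₁ h₁
      refine ⟨⟨H₁, ⟨h₁.1, ?_⟩, rfl⟩, ?_⟩
      · intro h
        rw [Set.mem_singleton_iff.1 h] at hl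
        exact lt_irrefl _ hl
      · exact (restrictLevel_comap hA hρ hH h₁.1 hl).trans h₁.2
  rw [himage]
  exact Set.InjOn.ncard_image fun H₁ h₁ H₂ h₂ h =>
    hρ.eq_of_comap_eq hA hH h₁.1 h₂.1 (hlt H₁ h₁) (hlt H₂ h₂) h

/-- Each occupied level strictly lowers the dimension of the flat, so there are at most $\dim V$ of
them. Padding with empty levels accounts for the exponents $0$. -/
theorem exists_levels [FiniteDimensional K V] (hA : IsCentralArrangement A)
    (hρ : HasModularLevels A ρ) :
    ∃ Λ : Finset ℕ, (∀ H ∈ A, ρ H ∈ Λ) ∧ Λ.card = Module.finrank K V := by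
  let f : ℕ → ℕ := fun k => Module.finrank K (sInf {H | H ∈ A ∧ ρ H < k} : Submodule K V)
  have hlt : ∀ H ∈ A, ∀ H' ∈ A, ρ H < ρ H' → f (ρ H') < f (ρ H) := by
    intro H hH H' hH' hl
    refine Submodule.finrank_lt_finrank_of_lt (lt_of_le_of_ne ?_ ?_)
    · exact sInf_le_sInf fun X hX => ⟨hX.1, hX.2.trans hl⟩
    · intro he
      refine hρ.not_sInf_le H hH (he.symm.le.trans ?_)
      exact sInf_le ⟨hH, hl⟩
  have hcard : (hA.1.toFinset.image ρ).card ≤ (Finset.Icc 1 (Module.finrank K V)).card := by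
    refine Finset.card_le_card_of_injOn f ?_ ?_
    · intro k hk
      obtain ⟨H, hH, rfl⟩ := Finset.mem_image.1 hk
      have hH := hA.1.mem_toFinset.1 hH
      refine Finset.mem_coe.2 (Finset.mem_Icc.2 ⟨?_, Submodule.finrank_le _⟩)
      rw [Submodule.one_le_finrank_iff]
      intro hbot
      exact hρ.not_sInf_le H hH (hbot ▸ bot_le)
    · intro k hk l hl hkl
      obtain ⟨H, hH, rfl⟩ := Finset.mem_image.1 hk
      obtain ⟨H', hH', rfl⟩ := Finset.mem_image.1 hl
      have hH := hA.1.mem_toFinset.1 hH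
      have hH' := hA.1.mem_toFinset.1 hH'
      rcases lt_trichotomy (ρ H) (ρ H') with h | h | h
      · exact absurd hkl (hlt H hH H' hH' h).ne'
      · exact h
      · exact absurd hkl (hlt H' hH' H hH h).ne
  rw [Nat.card_Icc, Nat.add_sub_cancel] at hcard
  obtain ⟨Λ, hsub, hΛ⟩ := Infinite.exists_superset_card_eq _ _ hcard
  exact ⟨Λ, fun H hH => hsub (Finset.mem_image_of_mem _ (hA.1.mem_toFinset.2 hH)), hΛ⟩

end HasModularLevels

/-- Induction on the number of hyperplanes, over all spaces at once because the restriction lives in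
$H$. For $H$ of top level, deletion lowers the size of its level by one and restriction removes that
level while keeping the sizes of the others, which is the numerical pattern of the addition theorem.
-/
theorem isInductivelyFree_and_hasExponents (n : ℕ) : ∀ {V : Type v} [AddCommGroup V] [Module K V]
    [FiniteDimensional K V] {A : Set (Submodule K V)} {ρ : Submodule K V → ℕ},
    IsCentralArrangement A → HasModularLevels A ρ → A.ncard = n → ∀ Λ : Finset ℕ,
    (∀ H ∈ A, ρ H ∈ Λ) → Λ.card = Module.finrank K V →
    IsInductivelyFree A ∧
      HasExponents A (Λ.val.map fun k => {H | H ∈ A ∧ ρ H = k}.ncard) := by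
  induction n using Nat.strong_induction_on with
  | _ n ih =>
  intro V _ _ _ A ρ hA hρ hn Λ hΛ hcard
  rcases Set.eq_empty_or_nonempty A with rfl | hne
  · refine ⟨.empty, ?_⟩
    have := hasExponents_empty (K := K) (V := V)
    rw [← hcard] at this
    simpa using this
  obtain ⟨H, hH, hmax⟩ := hA.1.exists_maximalFor ρ A hne |>.imp fun H h =>
    (⟨h.1, fun H' hH' => (le_total (ρ H') (ρ H)).elim id fun h' => h.2 hH' h'⟩ :
      H ∈ A ∧ ∀ H' ∈ A, ρ H' ≤ ρ H)
  have hr := hΛ H hH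
  have hlt : (A \ {H}).ncard < n := hn ▸ Set.ncard_sdiff_singleton_lt_of_mem hH hA.1
  have hlt' : (restriction A H).ncard < n := by
    have : restriction A H = (fun H' => H'.comap H.subtype) '' (A \ {H}) := by
      ext X
      simp only [restriction, Set.mem_image, Set.mem_ofPred_eq]
      exact exists_congr fun _ => and_congr_right fun _ => eq_comm
    rw [this]
    exact (Set.ncard_image_le (hA.delete H).1).trans_lt hlt
  have hrank : Module.finrank K H + 1 = Module.finrank K V := by
    conv_lhs => rw [← ker_defForm (hA.2 H hH)]
    exact Module.Dual.finrank_ker_add_one_of_ne_zero (defForm_ne_zero (hA.2 H hH))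
  obtain ⟨hIF', hE'⟩ := ih _ hlt (hA.delete H) (hρ.delete hmax) rfl Λ (fun X hX => hΛ X hX.1) hcard
  obtain ⟨hIF'', hE''⟩ := ih _ hlt' (hA.restrict hH) (hρ.restrict hA hH hmax) rfl (Λ.erase (ρ H))
    (by
      intro X hX
      obtain ⟨H₁, h₁, hl₁, rfl⟩ := hρ.exists_comap_eq hA hH hmax hX
      rw [HasModularLevels.restrictLevel_comap hA hρ hH h₁ hl₁]
      exact Finset.mem_erase.2 ⟨hl₁.ne, hΛ H₁ h₁⟩)
    (by rw [Finset.card_erase_of_mem hr]; omega)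
  have hval : Λ.val = ρ H ::ₘ (Λ.erase (ρ H)).val := by
    rw [← Finset.insert_val_of_notMem (Finset.notMem_erase _ _), Finset.insert_erase hr]
  have hdel : ∀ k, k ≠ ρ H →
      {X | X ∈ A \ {H} ∧ ρ X = k} = {X | X ∈ A ∧ ρ X = k} := by
    intro k hk
    ext X
    refine ⟨fun h => ⟨h.1.1, h.2⟩, fun h => ⟨⟨h.1, fun he => hk ?_⟩, h.2⟩⟩
    rw [← h.2, Set.mem_singleton_iff.1 he]
  have htop : {X | X ∈ A ∧ ρ X = ρ H}.ncard = {X | X ∈ A \ {H} ∧ ρ X = ρ H}.ncard + 1 := by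
    rw [← Set.ncard_insert_of_notMem (a := H) (fun h => h.1.2 rfl)
      ((hA.delete H).1.subset fun X hX => hX.1)]
    congr 1
    ext X
    by_cases hX : X = H
    · simp [hX, hH]
    · simp [hX]
  set m'' := (Λ.erase (ρ H)).val.map fun k =>
    {X | X ∈ restriction A H ∧ HasModularLevels.restrictLevel A ρ H X = k}.ncard with hm''
  have hne' : ∀ k ∈ (Λ.erase (ρ H)).val, k ≠ ρ H := fun k hk =>
    Finset.ne_of_mem_erase (show k ∈ Λ.erase (ρ H) from hk)
  have hmA : (Λ.erase (ρ H)).val.map (fun k => {X | X ∈ A ∧ ρ X = k}.ncard) = m'' :=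
    Multiset.map_congr rfl fun k hk => (hρ.ncard_restrict_level hA hH hmax (hne' k hk)).symm
  have hmA' : (Λ.erase (ρ H)).val.map (fun k => {X | X ∈ A \ {H} ∧ ρ X = k}.ncard) = m'' := by
    rw [← hmA]
    exact Multiset.map_congr rfl fun k hk => by rw [hdel k (hne' k hk)]
  rw [hval, Multiset.map_cons, hmA'] at hE'
  have hle := Multiset.le_cons_self m'' {X | X ∈ A \ {H} ∧ ρ X = ρ H}.ncard
  obtain ⟨e, he, hE⟩ := hE'.addition hA hH hE'' hle
  rw [Multiset.cons_inj_left] at he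
  refine ⟨.add A H hH hIF' hIF'' _ _ hE' hE'' hle, ?_⟩
  rw [hval, Multiset.map_cons, hmA, htop, he]
  exact hE

theorem HasModularLevels.isInductivelyFree {V : Type v} [AddCommGroup V] [Module K V]
    [FiniteDimensional K V] {A : Set (Submodule K V)} {ρ : Submodule K V → ℕ}
    (hA : IsCentralArrangement A) (hρ : HasModularLevels A ρ) : IsInductivelyFree A := by
  obtain ⟨Λ, hΛ, hcard⟩ := hρ.exists_levels hA
  exact (isInductivelyFree_and_hasExponents _ hA hρ rfl Λ hΛ hcard).1

end InductiveFreeness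

theorem theorem1p3 {K : Type*} [Field K] [CharZero K] (ℓ : ℕ) (hℓ : 2 ≤ ℓ)
    (N : Set.Icc 2 ℓ → Finset K) :
    List.TFAE [
      IsNest N,
      IsSupersolvable (coneNIsh N),
      IsInductivelyFree (coneNIsh N),
      IsFreeArrangement (coneNIsh N)] := by
  have hA := isCentralArrangement_coneNIsh N
  tfae_have 1 → 2 := by
    intro h
    obtain ⟨ρ, hρ⟩ := h.exists_hasModularLevels
    exact hρ.isSupersolvable hA
  tfae_have 2 → 3 := by
    rintro ⟨Δ, hΔ⟩
    exact (hΔ.hasModularLevels hA).isInductivelyFree hA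
  tfae_have 3 → 4 := fun h => h.isFreeArrangement hA
  tfae_have 4 → 1 := isNest_of_isFreeArrangement
  tfae_finish
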